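/- **Setting.** Consider a discrete-time linear time-invariant behavior $\mathcal B$ with variable $w=(y,u,d)$ (output $y\in\mathbb R^{\mathsf p}$, control input $u\in\mathbb R^{\mathsf m}$, disturbance $d\in\mathbb R^{\mathsf q}$) and lag at most $L$, in which $(u,d)$ is the (nonanticipating) input and $y$ the output. Let $\mathcal F$ be a matrix of full column rank whose column space is the set of all segments $\tilde w_k=w_{[k-L,k]}$ of trajectories of $\mathcal B$, so that $\tilde w_k=\mathcal F g_k$ for a unique $g_k$. Let $\Pi_f\mathcal F,\Pi_y\mathcal F,\Pi_u\mathcal F,\mathcal F_{dk},\mathcal F_{wp},\Pi_p\mathcal F$ be the rows of $\mathcal F$ belonging to $w_k$, $y_k$, $u_k$, $d_k$, $w_{[k-L,k-1]}$, $w_{[k-L+1,k]}$ respectively. With $A=\begin{bmatrix}\mathcal F_{wp}\\ \mathcal F_{dk}\end{bmatrix}$ and Moore–Penrose inverse $A^\dagger$, put $\mathcal F_p=A^\dagger\begin{bmatrix}\Pi_p\mathcal F\\0\end{bmatrix}$, $\mathcal F_f=A^\dagger\begin{bmatrix}0\\I\end{bmatrix}$, and let $\mathcal F_z$ have orthonormal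 columns ($\mathsf m$ of them) spanning the column space of $I-A^\dagger A$. Put $\mathcal E_u=\mathcal F_z(\Pi_u\mathcal F\mathcal F_z)^{-1}$, $\mathcal E_p=(I-\mathcal E_u\Pi_u\mathcal F)\mathcal F_p$, $\mathcal E_f=(I-\mathcal E_u\Pi_u\mathcal F)\mathcal F_f$. In each step $k\ge1$, $d_k=\bar d+\Delta d_k$ with constant mean $\bar d$, $u_k=\bar u_k+\Delta u_k$, and $w_k+n_k$ is measured. Here $\Delta d$ and $\Delta u$ are i.i.d. zero-mean sequences with covariances $\mathcal S_d,\mathcal S_u$, and $n$ is a zero-mean white noise with covariance $\mathcal S_n$; the processes $\Delta d,\Delta u,n$ are pairwise independent. The initial estimate $\hat g_{0|0}$ and its error $g_0-\hat g_{0|0}$ are square integrable and independent of each other, the pair $(g_0,\hat g_{0|0})$ is independent of each of $\Delta d,\Delta u,n$, and the error has mean zero and covariance $\mathcal P_{0|0}$. The estimates are updated by $$\hat g_{k|k}=\hat g_{k|k-1}+\mathcal K_k(w_k+n_k-\Pi_f\mathcal F\hat g_{k|k-1}),\qquad \mathcal K_k=\mathcal P_{k|k-1}\mathcal F^\top\Pi_f^\top(\Pi_f\mathcal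 F\mathcal P_{k|k-1}\mathcal F^\top\Pi_f^\top+\mathcal S_n)^{-1},$$ $$\mathcal P_{k|k-1}=\mathcal E_p\mathcal P_{k-1|k-1}\mathcal E_p^\top+\mathcal Q,\qquad \mathcal P_{k|k}=(I-\mathcal K_k\Pi_f\mathcal F)\mathcal P_{k|k-1},\qquad \mathcal Q=\mathcal E_f\mathcal S_d\mathcal E_f^\top+\mathcal E_u\mathcal S_u\mathcal E_u^\top .$$ With $\mathcal A=\Pi_f\mathcal F\mathcal E_p$, $\mathcal T=\Pi_f\mathcal F\mathcal Q$, $\mathcal R=\Pi_f\mathcal F\mathcal Q\mathcal F^\top\Pi_f^\top+\mathcal S_n$, assume that $\mathcal R$ is positive definite (for example $\mathcal S_n>0$), and let $\mathcal P$ be the unique positive semidefinite solution of $$\mathcal P=\mathcal E_p\mathcal P\mathcal E_p^\top-\mathcal N+\mathcal Q,\qquad \mathcal N=(\mathcal A\mathcal P\mathcal E_p^\top+\mathcal T)^\top(\mathcal A\mathcal P\mathcal A^\top+\mathcal R)^{-1}(\mathcal A\mathcal P\mathcal E_p^\top+\mathcal T).$$ **Theorem.** Let $\gamma_1,\gamma_2\ge0$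 and $\operatorname{tr}(\mathcal S_d)+\|\bar d\|^2>0$. Suppose that there are symmetric matrices $W,X$, a matrix $Y$ and a vector $\xi$ with $W>0$, $$\begin{bmatrix}X&*&*\\ \mathcal N^{1/2}&W&*\\ \Pi_y\mathcal F\mathcal P^{1/2}&0&I\end{bmatrix}\ge0,\qquad \begin{bmatrix}\phi&*&*&*\\0&W&*&*\\0&\Pi_y\mathcal FW&I&*\\ \mathcal F_f\bar d+\mathcal F_z\xi&\mathcal F_pW+\mathcal F_zY&0&W\end{bmatrix}\ge0,$$ where $\phi=\gamma_1^2\|\bar d\|^2+\gamma_2^2\operatorname{tr}(\mathcal S_d)-\operatorname{tr}(X)$. Then the controller $$\hat g_{k|k-1}=(\mathcal F_p+\mathcal F_zYW^{-1})\hat g_{k-1|k-1}+\mathcal F_f\bar d+\mathcal F_z\xi,\qquad \bar u_k=\Pi_u\mathcal F\hat g_{k|k-1}$$ can be implemented (the controlled system has a process $w$ with paths in $\mathcal B$ and initial segment $\mathcal Fg_0$), and for each such process, with $\Gamma_T=\|y_{[1,T]}\|/\|d_{[1,T]}\|$ and $\rho=\|\bar d\|^2/(\operatorname{tr}(\mathcal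 S_d)+\|\bar d\|^2)$, $$\mathbb P\Big\{\liminf_{T\to\infty}\mathbb P\{\Gamma_T\le\gamma\}\ge1-\frac1{\gamma^2}\big(\rho\gamma_1^2+(1-\rho)\gamma_2^2\big)\Big\}=1$$ for every $\gamma>0$ with $\gamma\ge\sqrt{\rho\gamma_1^2+(1-\rho)\gamma_2^2}$. -/

import Mathlib

open MeasureTheory ProbabilityTheory Filter Matrix
open scoped ENNReal

noncomputable section

namespace ProbGain

/-! ### Moore-Penrose inverse and positive semidefinite square root -/

/-- `B` satisfies the four Penrose equations for the real matrix `A`. -/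
structure IsMoorePenrose {m n : Type*} [Fintype m] [Fintype n]
    (A : Matrix m n ℝ) (B : Matrix n m ℝ) : Prop where
  mul_mul : A * B * A = A
  mul_mul' : B * A * B = B
  symm : (A * B)ᵀ = A * B
  symm' : (B * A)ᵀ = B * A

theorem exists_isMoorePenrose {m n : Type*} [Fintype m] [Fintype n]
    (A : Matrix m n ℝ) : ∃ B : Matrix n m ℝ, IsMoorePenrose A B := by
  classical
  have hH : (Aᵀ * A).IsHermitian := by
    rw [← conjTranspose_eq_transpose_of_trivial]; exact isHermitian_conjTranspose_mul_self A
  obtain ⟨U, hU, D, hD⟩ : ∃ U : Matrix n n ℝ, Uᵀ * U = 1 ∧ ∃ D : n → ℝ,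
      Aᵀ * A = U * diagonal D * Uᵀ := by
    refine ⟨hH.eigenvectorUnitary, ?_, hH.eigenvalues, ?_⟩
    · have := Unitary.coe_star_mul_self hH.eigenvectorUnitary
      rwa [star_eq_conjTranspose, conjTranspose_eq_transpose_of_trivial] at this
    · have := hH.spectral_theorem
      rw [Unitary.conjStarAlgAut_apply] at this
      rw [star_eq_conjTranspose, conjTranspose_eq_transpose_of_trivial] at this
      simpa using this
  set G : Matrix n n ℝ := U * diagonal (fun i => (D i)⁻¹) * Uᵀ with hG
  have hUU : ∀ X : Matrix n n ℝ, Uᵀ * (U * X) = X := fun X => by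
    rw [← Matrix.mul_assoc, hU, Matrix.one_mul]
  have hGt : Gᵀ = G := by simp [hG, Matrix.transpose_mul, Matrix.mul_assoc]
  have hHGH : Aᵀ * A * G * (Aᵀ * A) = Aᵀ * A := by
    rw [hD, hG]
    simp only [Matrix.mul_assoc, hUU]
    congr 1
    simp only [← Matrix.mul_assoc, diagonal_mul_diagonal]
    congr 2
    funext i
    by_cases h : D i = 0 <;> simp [h]
  have hGHG : G * (Aᵀ * A) * G = G := by
    rw [hD, hG]
    simp only [Matrix.mul_assoc, hUU]
    congr 1
    simp only [← Matrix.mul_assoc, diagonal_mul_diagonal]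
    congr 2
    funext i
    by_cases h : D i = 0 <;> simp [h]
  have hcomm : G * (Aᵀ * A) = Aᵀ * A * G := by
    rw [hD, hG]
    simp only [Matrix.mul_assoc, hUU]
    congr 1
    simp only [← Matrix.mul_assoc, diagonal_mul_diagonal]
    congr 2
    funext i
    ring
  have hHt : (Aᵀ * A)ᵀ = Aᵀ * A := by simp [Matrix.transpose_mul]
  refine ⟨G * Aᵀ, ?_, ?_, ?_, ?_⟩
  · have h0 : Aᴴ * A * (G * (Aᵀ * A) - 1) = 0 := by
      rw [conjTranspose_eq_transpose_of_trivial, Matrix.mul_sub, Matrix.mul_one,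
        ← Matrix.mul_assoc, hHGH, sub_self]
    rw [conjTranspose_mul_self_mul_eq_zero, Matrix.mul_sub, Matrix.mul_one, sub_eq_zero] at h0
    simpa only [Matrix.mul_assoc] using h0
  · calc G * Aᵀ * A * (G * Aᵀ) = G * (Aᵀ * A) * G * Aᵀ := by simp only [Matrix.mul_assoc]
      _ = G * Aᵀ := by rw [hGHG]
  · simp [Matrix.transpose_mul, hGt, Matrix.mul_assoc]
  · rw [Matrix.mul_assoc, Matrix.transpose_mul, hHt, hGt, hcomm]

/-- The Moore-Penrose inverse `A†`. -/
def pinv {m n : Type*} [Fintype m] [Fintype n] (A : Matrix m n ℝ) : Matrix n m ℝ :=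
  Classical.choose (exists_isMoorePenrose A)

theorem pinv_spec {m n : Type*} [Fintype m] [Fintype n] (A : Matrix m n ℝ) :
    IsMoorePenrose A (pinv A) :=
  Classical.choose_spec (exists_isMoorePenrose A)

open scoped MatrixOrder in
/-- The positive semidefinite square root of a positive semidefinite matrix. -/
def psdSqrt {n : Type*} [Fintype n] [DecidableEq n] (A : Matrix n n ℝ) : Matrix n n ℝ :=
  CFC.sqrt A

open scoped MatrixOrder in
theorem psdSqrt_spec {n : Type*} [Fintype n] [DecidableEq n] {A : Matrix n n ℝ}
    (hA : A.PosSemidef) : (psdSqrt A).PosSemidef ∧ psdSqrt A * psdSqrt A = A :=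
  ⟨(CFC.sqrt_nonneg A).posSemidef, CFC.sqrt_mul_sqrt_self A hA.nonneg⟩

/-! ### Linear time-invariant behaviors

The manifest variable is `w = (y, u, d)` with `p` outputs, `m` control inputs and
`q` disturbances. -/

/-- Index set of the components of `w = (y, u, d)`. -/
abbrev Sig (p m q : ℕ) : Type := Fin p ⊕ Fin m ⊕ Fin q

/-- Deterministic trajectories `ℕ → ℝ^(p+m+q)`. -/
abbrev Traj (p m q : ℕ) : Type := ℕ → Sig p m q → ℝ

/-- The input part `(u, d)` of a value of `w`. -/
def inputPart {p m q : ℕ} (v : Sig p m q → ℝ) : Fin m ⊕ Fin q → ℝ := fun a => v (Sum.inr a)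

/-- `B` is the behavior of a linear time-invariant system of lag at most `L`: it is the solution
set of finitely many constant-coefficient linear difference equations of order at most `L`. -/
def IsLTIBehavior {p m q : ℕ} (L : ℕ) (B : Set (Traj p m q)) : Prop :=
  ∃ (s : ℕ) (R : Fin (L + 1) → Matrix (Fin s) (Sig p m q) ℝ),
    B = {w | ∀ k : ℕ, ∑ i : Fin (L + 1), R i *ᵥ w (k + i) = 0}

/-- `(u, d)` is the input and `y` the output of `B`, and `B` is nonanticipating:
the input is free, also after any past of any trajectory, and a trajectory is determined by
its input together with a finite initial piece (no component of `y` is free). -/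
structure IsInputOutput {p m q : ℕ} (B : Set (Traj p m q)) : Prop where
  free : ∀ w ∈ B, ∀ (k : ℕ) (v : ℕ → Fin m ⊕ Fin q → ℝ), (∀ j < k, v j = inputPart (w j)) →
    ∃ w' ∈ B, (∀ j < k, w' j = w j) ∧ ∀ j, inputPart (w' j) = v j
  determined : ∃ N : ℕ, ∀ w ∈ B, ∀ w' ∈ B, (∀ j, inputPart (w j) = inputPart (w' j)) →
    (∀ j < N, w j = w' j) → w = w'

/-- The segment `w_[k, k+L]`, stacked into one vector. -/
def segment {p m q : ℕ} (L : ℕ) (w : Traj p m q) (k : ℕ) : Fin (L + 1) × Sig p m q → ℝ :=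
  fun a => w (k + a.1) a.2

/-- The `(L+1)`-step behavior. -/
def restricted {p m q : ℕ} (L : ℕ) (B : Set (Traj p m q)) :
    Set (Fin (L + 1) × Sig p m q → ℝ) :=
  {v | ∃ w ∈ B, ∃ k : ℕ, v = segment L w k}

/-! ### The data of the design problem -/

/-- The matrices that describe the problem: the representation matrix `F` of the `(L+1)`-step
behavior (`r` is the dimension of the parameterizer), the basis matrix `Fz` of the virtual
input, and the covariances of the disturbance deviation, the input uncertainty and the
measurement noise. -/
structure Setup (p m q L r : ℕ) where
  F : Matrix (Fin (L + 1) × Sig p m q) (Fin r) ℝ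
  Fz : Matrix (Fin r) (Fin m) ℝ
  Sd : Matrix (Fin q) (Fin q) ℝ
  Su : Matrix (Fin m) (Fin m) ℝ
  Sn : Matrix (Sig p m q) (Sig p m q) ℝ

namespace Setup

variable {p m q L r : ℕ} (S : Setup p m q L r)

/-- `F` has full column rank and its column space is the `(L+1)`-step behavior of `B`. -/
def Represents (B : Set (Traj p m q)) : Prop :=
  Function.Injective S.F.mulVec ∧ Set.range S.F.mulVec = restricted L B

/-- `Π_f F`: the rows of `F` that give the current value `w_k` of the segment `w_[k-L, k]`. -/
def Fcur : Matrix (Sig p m q) (Fin r) ℝ := S.F.submatrix (fun a => (Fin.last L, a)) id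

/-- `Π_y F`: the rows of `F` that give `y_k`. -/
def Fy : Matrix (Fin p) (Fin r) ℝ := S.F.submatrix (fun a => (Fin.last L, Sum.inl a)) id

/-- `Π_u F`: the rows of `F` that give `u_k`. -/
def Fu : Matrix (Fin m) (Fin r) ℝ := S.F.submatrix (fun a => (Fin.last L, Sum.inr (Sum.inl a))) id

/-- `F_dk`: the rows of `F` that give `d_k`. -/
def Fdk : Matrix (Fin q) (Fin r) ℝ := S.F.submatrix (fun a => (Fin.last L, Sum.inr (Sum.inr a))) id

/-- `F_wp`: the rows of `F` that give `w_[k-L, k-1]`. -/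
def Fwp : Matrix (Fin L × Sig p m q) (Fin r) ℝ := S.F.submatrix (fun a => (a.1.castSucc, a.2)) id

/-- `Π_p F`: the rows of `F` that give `w_[k-L+1, k]`. -/
def PipF : Matrix (Fin L × Sig p m q) (Fin r) ℝ := S.F.submatrix (fun a => (a.1.succ, a.2)) id

/-- The stacked matrix `col(F_wp, F_dk)`. -/
def stack : Matrix ((Fin L × Sig p m q) ⊕ Fin q) (Fin r) ℝ := fromRows S.Fwp S.Fdk

/-- `F_p = col(F_wp, F_dk)† col(Π_p F, 0)`. -/
def Fp : Matrix (Fin r) (Fin r) ℝ := pinv S.stack * fromRows S.PipF 0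

/-- `F_f = col(F_wp, F_dk)† col(0, I)`. -/
def Ff : Matrix (Fin r) (Fin q) ℝ := pinv S.stack * fromRows 0 1

/-- `F_z` has orthonormal columns, which span the column space of `I - A† A`, where
`A = col(F_wp, F_dk)`. -/
def IsVirtualInputBasis : Prop :=
  S.Fzᵀ * S.Fz = 1 ∧
    Set.range S.Fz.mulVec = Set.range (1 - pinv S.stack * S.stack).mulVec

/-- `E_u = F_z (Π_u F F_z)⁻¹`. -/
def Eu : Matrix (Fin r) (Fin m) ℝ := S.Fz * (S.Fu * S.Fz)⁻¹

/-- `E_p = [I - F_z (Π_u F F_z)⁻¹ Π_u F] F_p`. -/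
def Ep : Matrix (Fin r) (Fin r) ℝ := (1 - S.Fz * (S.Fu * S.Fz)⁻¹ * S.Fu) * S.Fp

/-- `E_f = [I - F_z (Π_u F F_z)⁻¹ Π_u F] F_f`. -/
def Ef : Matrix (Fin r) (Fin q) ℝ := (1 - S.Fz * (S.Fu * S.Fz)⁻¹ * S.Fu) * S.Ff

/-! ### The optimal filter and its Riccati equation -/

/-- `𝒬 = E_f S_d E_fᵀ + E_u S_u E_uᵀ`. -/
def Q : Matrix (Fin r) (Fin r) ℝ := S.Ef * S.Sd * S.Efᵀ + S.Eu * S.Su * S.Euᵀ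

/-- `𝒜 = Π_f F E_p`. -/
def A : Matrix (Sig p m q) (Fin r) ℝ := S.Fcur * S.Ep

/-- `ℛ = Π_f F (E_f S_d E_fᵀ + E_u S_u E_uᵀ) Fᵀ Π_fᵀ + S_n`. -/
def R : Matrix (Sig p m q) (Sig p m q) ℝ := S.Fcur * S.Q * S.Fcurᵀ + S.Sn

/-- `𝒯 = Π_f F (E_f S_d E_fᵀ + E_u S_u E_uᵀ)`. -/
def T : Matrix (Sig p m q) (Fin r) ℝ := S.Fcur * S.Q

/-- `𝒩 = (𝒜 P E_pᵀ + 𝒯)ᵀ (𝒜 P 𝒜ᵀ + ℛ)⁻¹ (𝒜 P E_pᵀ + 𝒯)`. -/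
def N (P : Matrix (Fin r) (Fin r) ℝ) : Matrix (Fin r) (Fin r) ℝ :=
  (S.A * P * S.Epᵀ + S.T)ᵀ * (S.A * P * S.Aᵀ + S.R)⁻¹ * (S.A * P * S.Epᵀ + S.T)

/-- `P` is a positive semidefinite solution of the algebraic Riccati equation. -/
def SolvesARE (P : Matrix (Fin r) (Fin r) ℝ) : Prop :=
  P.PosSemidef ∧ P = S.Ep * P * S.Epᵀ - S.N P + S.Q

/-- `P` is the solution of the algebraic Riccati equation: it is a positive semidefinite
solution, and there is no other. -/
def IsTheARESolution (P : Matrix (Fin r) (Fin r) ℝ) : Prop :=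
  S.SolvesARE P ∧ ∀ P', S.SolvesARE P' → P' = P

/-- The prior error covariance `P_{k|k-1}` as a function of `P_{k-1|k-1}`. -/
def priorCov (P : Matrix (Fin r) (Fin r) ℝ) : Matrix (Fin r) (Fin r) ℝ :=
  S.Ep * P * S.Epᵀ + S.Ef * S.Sd * S.Efᵀ + S.Eu * S.Su * S.Euᵀ

/-- The optimal gain `K_k` as a function of `P_{k|k-1}`. -/
def gain (P : Matrix (Fin r) (Fin r) ℝ) : Matrix (Fin r) (Sig p m q) ℝ :=
  P * S.Fcurᵀ * (S.Fcur * P * S.Fcurᵀ + S.Sn)⁻¹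

/-- The posterior error covariance `P_{k|k}` of the filter started from `P_{0|0} = P₀`. -/
def postCov (P₀ : Matrix (Fin r) (Fin r) ℝ) : ℕ → Matrix (Fin r) (Fin r) ℝ
  | 0 => P₀
  | k + 1 =>
    (1 - S.gain (S.priorCov (postCov P₀ k)) * S.Fcur) * S.priorCov (postCov P₀ k)

/-! ### The controller -/

/-- The prior estimate `ĝ_{k|k-1} = F_p ĝ + F_f d̄ + F_z ẑ` with the virtual input
`ẑ = Y W⁻¹ ĝ + ξ`, where `ĝ = ĝ_{k-1|k-1}`. -/
def prior (W : Matrix (Fin r) (Fin r) ℝ) (Y : Matrix (Fin m) (Fin r) ℝ) (ξ : Fin m → ℝ)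
    (dbar : Fin q → ℝ) (g : Fin r → ℝ) : Fin r → ℝ :=
  (S.Fp + S.Fz * Y * W⁻¹) *ᵥ g + S.Ff *ᵥ dbar + S.Fz *ᵥ ξ

/-- The posterior estimates `ĝ_{k|k}` along a trajectory `w`. The initial segment occupies the
times `0, …, L`, so step `k + 1` takes place at time `L + 1 + k`; its measurement noise is
`n k`. -/
def posterior (W : Matrix (Fin r) (Fin r) ℝ) (Y : Matrix (Fin m) (Fin r) ℝ) (ξ : Fin m → ℝ)
    (dbar : Fin q → ℝ) (P₀ : Matrix (Fin r) (Fin r) ℝ) (ghat₀ : Fin r → ℝ)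
    (w : Traj p m q) (n : ℕ → Sig p m q → ℝ) : ℕ → Fin r → ℝ
  | 0 => ghat₀
  | k + 1 =>
    S.prior W Y ξ dbar (posterior W Y ξ dbar P₀ ghat₀ w n k) +
      S.gain (S.priorCov (S.postCov P₀ k)) *ᵥ
        (w (L + 1 + k) + n k
          - S.Fcur *ᵥ S.prior W Y ξ dbar (posterior W Y ξ dbar P₀ ghat₀ w n k))

/-- `w` is the stochastic process of the controlled system: every path belongs to the behavior
`B` and starts with the segment `F g₀`, and in each step `u = ū + Δu` with
`ū = Π_u F ĝ_{k|k-1}` and `d = d̄ + Δd`. Step `k + 1` takes place at time `L + 1 + k`, and its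
deviations and noise are `du k`, `dd k` and `n k`. -/
structure IsControlled {Ω : Type*} (B : Set (Traj p m q))
    (W : Matrix (Fin r) (Fin r) ℝ) (Y : Matrix (Fin m) (Fin r) ℝ) (ξ : Fin m → ℝ)
    (dbar : Fin q → ℝ) (P₀ : Matrix (Fin r) (Fin r) ℝ) (g₀ ghat₀ : Ω → Fin r → ℝ)
    (dd : ℕ → Ω → Fin q → ℝ) (du : ℕ → Ω → Fin m → ℝ) (n : ℕ → Ω → Sig p m q → ℝ)
    (w : ℕ → Ω → Sig p m q → ℝ) : Prop where
  mem : ∀ ω, (fun t => w t ω) ∈ B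
  init : ∀ ω, segment L (fun t => w t ω) 0 = S.F *ᵥ g₀ ω
  control : ∀ k ω a, w (L + 1 + k) ω (Sum.inr (Sum.inl a)) =
    (S.Fu *ᵥ S.prior W Y ξ dbar
      (S.posterior W Y ξ dbar P₀ (ghat₀ ω) (fun t => w t ω) (fun t => n t ω) k)) a + du k ω a
  disturbance : ∀ k ω b, w (L + 1 + k) ω (Sum.inr (Sum.inr b)) = dbar b + dd k ω b

/-! ### The matrix inequalities -/

/-- The block matrix
`[X, *, *; 𝒩^(1/2), W, *; Π_y F P^(1/2), 0, I]`. -/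
def offsetLMI (P W X : Matrix (Fin r) (Fin r) ℝ) :
    Matrix (Fin r ⊕ (Fin r ⊕ Fin p)) (Fin r ⊕ (Fin r ⊕ Fin p)) ℝ :=
  fromBlocks X (fromCols (psdSqrt (S.N P))ᵀ (S.Fy * psdSqrt P)ᵀ)
    (fromRows (psdSqrt (S.N P)) (S.Fy * psdSqrt P)) (fromBlocks W 0 0 1)

/-- The block matrix
`[φ, *, *, *; 0, W, *, *; 0, Π_y F W, I, *; F_f d̄ + F_z ξ, F_p W + F_z Y, 0, W]`. -/
def dissLMI (φ : ℝ) (W : Matrix (Fin r) (Fin r) ℝ) (Y : Matrix (Fin m) (Fin r) ℝ)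
    (ξ : Fin m → ℝ) (dbar : Fin q → ℝ) :
    Matrix (Unit ⊕ (Fin r ⊕ (Fin p ⊕ Fin r))) (Unit ⊕ (Fin r ⊕ (Fin p ⊕ Fin r))) ℝ :=
  fromBlocks (of fun _ _ => φ)
    (fromCols 0 (fromCols 0 (replicateCol Unit (S.Ff *ᵥ dbar + S.Fz *ᵥ ξ))ᵀ))
    (fromRows 0 (fromRows 0 (replicateCol Unit (S.Ff *ᵥ dbar + S.Fz *ᵥ ξ))))
    (fromBlocks W (fromCols (S.Fy * W)ᵀ (S.Fp * W + S.Fz * Y)ᵀ)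
      (fromRows (S.Fy * W) (S.Fp * W + S.Fz * Y)) (fromBlocks 1 0 0 W))

end Setup

/-! ### Stochastic processes -/

/-- `v` is a zero-mean square-integrable white noise with covariance matrix `C`. -/
structure IsWhiteNoise {Ω ι : Type*} [MeasurableSpace Ω] [Fintype ι] (μ : Measure Ω)
    (v : ℕ → Ω → ι → ℝ) (C : Matrix ι ι ℝ) : Prop where
  memLp : ∀ k, MemLp (v k) 2 μ
  mean : ∀ k a, ∫ ω, v k ω a ∂μ = 0
  cov : ∀ j k a b, ∫ ω, v j ω a * v k ω b ∂μ = if j = k then C a b else 0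

/-- `v` is a white noise that is moreover independent and identically distributed. -/
structure IsIIDNoise {Ω ι : Type*} [MeasurableSpace Ω] [Fintype ι] (μ : Measure Ω)
    (v : ℕ → Ω → ι → ℝ) (C : Matrix ι ι ℝ) : Prop extends IsWhiteNoise μ v C where
  indep : iIndepFun v μ
  ident : ∀ k, IdentDistrib (v k) (v 0) μ μ

/-- A stochastic process as one random variable with values in the space of paths. -/
def path {Ω ι : Type*} (v : ℕ → Ω → ι → ℝ) : Ω → ℕ → ι → ℝ := fun ω k => v k ω

/-- `Γ_T = ‖y_[1,T]‖ / ‖d_[1,T]‖` along a path, with Euclidean norms; step `k + 1` takes place at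
time `L + 1 + k`. It is an extended number: `c / 0 = ∞` for `c > 0`. -/
def gainRatio {p m q : ℕ} (L : ℕ) (w : Traj p m q) (T : ℕ) : ℝ≥0∞ :=
  ENNReal.ofReal √(∑ k ∈ Finset.range T, ∑ a : Fin p, w (L + 1 + k) (Sum.inl a) ^ 2) /
    ENNReal.ofReal √(∑ k ∈ Finset.range T, ∑ b : Fin q, w (L + 1 + k) (Sum.inr (Sum.inr b)) ^ 2)

end ProbGain

end

open ProbGain

namespace ProbGain

open scoped MatrixOrder Topology

/-! ### Real positive semidefinite matrices -/

section PSD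

variable {ι κ : Type*} [Fintype ι] [Fintype κ]

/-! Parameterizing segments turns the behavior into a state-space system with state `g`: because the
input is free, every segment has a continuation with prescribed `u` and `d`, and its parameter is
the affine expression `advance` (`isSuccessor_advance`, `IsSuccessor.eq_advance`). The prior
estimate is the same map applied to the estimate and the mean inputs (`prior_eq_advance`), so the
controller cancels from the error, which obeys `e ↦ E_p e + η` before the correction, with white `η
= E_f Δd + E_u Δu`. The estimator is therefore a Kalman filter: its error covariance follows a
deterministic Riccati recursion, estimate and error stay uncorrelated, and each correction adds `N`
of the current covariance to the second moment of the estimate (`FilterMoments.step`).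

The covariance converges to `P` by an order argument (`tendsto_postCov`). The Riccati map is
monotone. A segment has only `L + 1` samples, so a suboptimal estimator forgets any initial error in
`L + 1` steps, which bounds all iterates from there on by one matrix `C`. Iterates from `0`
increase, those from `C` decrease along every `(L+1)`-st step, and uniqueness of the Riccati
solution forces both limits to be `P`.

The energy bound uses the storage function `xᵀ W⁻¹ x` of the estimate. The second matrix inequality
is its dissipation inequality with supply `φ` (`dissipation`). In the mean, filtering costs an
additional `tr(W⁻¹ N) + tr(Fyᵀ Fy P)`, which the first matrix inequality bounds by `tr X` in the
limit (`offset_trace_le`). Telescoping and Cesàro averaging bound the mean output energy per step by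
`γ₁²‖d̄‖² + γ₂² tr S_d`. The disturbance energy per step tends almost surely to `tr S_d + ‖d̄‖²` by
the strong law, and Markov's inequality for the output energy gives the probability
(`le_liminf_measureReal_sqrt_div_le`). -/

theorem posSemidef_of_quadratic {A : Matrix ι ι ℝ} (hs : Aᵀ = A)
    (h : ∀ x, 0 ≤ x ⬝ᵥ (A *ᵥ x)) : A.PosSemidef :=
  .of_dotProduct_mulVec_nonneg (by simpa [IsHermitian] using hs) (by simpa using h)

theorem PosSemidef.quadratic_nonneg {A : Matrix ι ι ℝ} (hA : A.PosSemidef) (x : ι → ℝ) :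
    0 ≤ x ⬝ᵥ (A *ᵥ x) := by
  simpa using hA.dotProduct_mulVec_nonneg x

theorem PosSemidef.transpose_eq {ι : Type*} {A : Matrix ι ι ℝ} (hA : A.PosSemidef) : Aᵀ = A := by
  simpa [IsHermitian] using hA.isHermitian

theorem PosSemidef.mul_mul_transpose {A : Matrix ι ι ℝ} (hA : A.PosSemidef) (M : Matrix κ ι ℝ) :
    (M * A * Mᵀ).PosSemidef := by
  simpa using hA.mul_mul_conjTranspose_same M

theorem mul_mul_transpose_mono {A B : Matrix ι ι ℝ} (h : A ≤ B) (M : Matrix κ ι ℝ) :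
    M * A * Mᵀ ≤ M * B * Mᵀ := by
  rw [Matrix.le_iff] at h ⊢
  have := PosSemidef.mul_mul_transpose h M
  rwa [Matrix.mul_sub, Matrix.sub_mul] at this

theorem quadratic_mono {A B : Matrix ι ι ℝ} (h : A ≤ B) (x : ι → ℝ) :
    x ⬝ᵥ (A *ᵥ x) ≤ x ⬝ᵥ (B *ᵥ x) := by
  have := PosSemidef.quadratic_nonneg (Matrix.le_iff.1 h) x
  rw [Matrix.sub_mulVec, dotProduct_sub] at this
  linarith

/-- The entries of a symmetric matrix are determined by its quadratic form. -/
theorem apply_eq_polarization [DecidableEq ι] {A : Matrix ι ι ℝ} (hA : Aᵀ = A) (i j : ι) :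
    A i j = ((Pi.single i 1 + Pi.single j 1) ⬝ᵥ (A *ᵥ (Pi.single i 1 + Pi.single j 1))
      - Pi.single i 1 ⬝ᵥ (A *ᵥ Pi.single i 1) - Pi.single j 1 ⬝ᵥ (A *ᵥ Pi.single j 1)) / 2 := by
  have : A j i = A i j := congrFun (congrFun hA i) j
  simp [Matrix.mulVec_add, add_dotProduct, this]
  ring

theorem tendsto_of_tendsto_quadratic {α : Type*} {l : Filter α} {A : α → Matrix ι ι ℝ}
    {B : Matrix ι ι ℝ} (hA : ∀ a, (A a)ᵀ = A a) (hB : Bᵀ = B)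
    (h : ∀ x, Tendsto (fun a => x ⬝ᵥ (A a *ᵥ x)) l (𝓝 (x ⬝ᵥ (B *ᵥ x)))) :
    Tendsto A l (𝓝 B) := by
  classical
  refine tendsto_pi_nhds.2 fun i => tendsto_pi_nhds.2 fun j => ?_
  rw [apply_eq_polarization hB i j]
  simp_rw [fun a => apply_eq_polarization (hA a) i j]
  exact (((h _).sub (h _)).sub (h _)).div_const 2

theorem tendsto_quadratic {α : Type*} {l : Filter α} {A : α → Matrix ι ι ℝ}
    {B : Matrix ι ι ℝ} (h : Tendsto A l (𝓝 B)) (x : ι → ℝ) :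
    Tendsto (fun a => x ⬝ᵥ (A a *ᵥ x)) l (𝓝 (x ⬝ᵥ (B *ᵥ x))) := by
  have : Continuous fun M : Matrix ι ι ℝ => x ⬝ᵥ (M *ᵥ x) := by fun_prop
  exact (this.tendsto B).comp h

theorem tendsto_squeeze {α : Type*} {l : Filter α} {A B C : α → Matrix ι ι ℝ}
    {M : Matrix ι ι ℝ} (hB : ∀ a, (B a)ᵀ = B a) (hM : Mᵀ = M)
    (hAt : Tendsto A l (𝓝 M)) (hCt : Tendsto C l (𝓝 M))
    (hAB : ∀ a, A a ≤ B a) (hBC : ∀ a, B a ≤ C a) : Tendsto B l (𝓝 M) :=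
  tendsto_of_tendsto_quadratic hB hM fun x =>
    tendsto_of_tendsto_of_tendsto_of_le_of_le (tendsto_quadratic hAt x) (tendsto_quadratic hCt x)
      (fun a => quadratic_mono (hAB a) x) (fun a => quadratic_mono (hBC a) x)

theorem posSemidef_of_tendsto {α : Type*} {l : Filter α} [l.NeBot] {A : α → Matrix ι ι ℝ}
    {B : Matrix ι ι ℝ} (h : Tendsto A l (𝓝 B)) (hA : ∀ a, (A a).PosSemidef) :
    B.PosSemidef := by
  refine posSemidef_of_quadratic ?_ fun x =>
    ge_of_tendsto' (tendsto_quadratic h x) fun a => PosSemidef.quadratic_nonneg (hA a) x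
  have h1 : Tendsto (fun a => (A a)ᵀ) l (𝓝 Bᵀ) :=
    ((continuous_id.matrix_transpose).tendsto B).comp h
  simp_rw [fun a => PosSemidef.transpose_eq (hA a)] at h1
  exact tendsto_nhds_unique h1 h

/-- A monotone sequence of symmetric matrices with an upper bound converges. -/
theorem exists_tendsto_of_monotone {A : ℕ → Matrix ι ι ℝ} {C : Matrix ι ι ℝ}
    (hs : ∀ k, (A k)ᵀ = A k) (hmono : Monotone A) (hC : ∀ k, A k ≤ C) :
    ∃ B : Matrix ι ι ℝ, Tendsto A atTop (𝓝 B) := by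
  classical
  have hq : ∀ x : ι → ℝ, ∃ c, Tendsto (fun k => x ⬝ᵥ (A k *ᵥ x)) atTop (𝓝 c) := fun x =>
    ⟨_, tendsto_atTop_ciSup (fun i j hij => quadratic_mono (hmono hij) x)
      ⟨x ⬝ᵥ (C *ᵥ x), by rintro _ ⟨k, rfl⟩; exact quadratic_mono (hC k) x⟩⟩
  choose c hc using hq
  refine ⟨of fun i j => (c (Pi.single i 1 + Pi.single j 1) - c (Pi.single i 1)
    - c (Pi.single j 1)) / 2, tendsto_pi_nhds.2 fun i => tendsto_pi_nhds.2 fun j => ?_⟩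
  simp_rw [fun k => apply_eq_polarization (hs k) i j]
  exact (((hc _).sub (hc _)).sub (hc _)).div_const 2

/-- An antitone sequence of positive semidefinite matrices converges. -/
theorem exists_tendsto_of_antitone {A : ℕ → Matrix ι ι ℝ} (h0 : ∀ k, (A k).PosSemidef)
    (hanti : Antitone A) : ∃ B : Matrix ι ι ℝ, Tendsto A atTop (𝓝 B) := by
  obtain ⟨B, hB⟩ := exists_tendsto_of_monotone (A := fun k => - A k) (C := 0)
    (fun k => by simp [PosSemidef.transpose_eq (h0 k)])
    (fun i j hij => neg_le_neg (hanti hij)) (fun k => by simpa using (h0 k).nonneg)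
  exact ⟨-B, by simpa using hB.neg⟩

theorem tendsto_matrix_mul {α κ ν : Type*} {l : Filter α} {A : α → Matrix κ ι ℝ}
    {A' : α → Matrix ι ν ℝ} {B : Matrix κ ι ℝ} {B' : Matrix ι ν ℝ} (h : Tendsto A l (𝓝 B))
    (h' : Tendsto A' l (𝓝 B')) : Tendsto (fun a => A a * A' a) l (𝓝 (B * B')) :=
  (((continuous_fst (X := Matrix κ ι ℝ) (Y := Matrix ι ν ℝ)).matrix_mul
    continuous_snd).tendsto (B, B')).comp (h.prodMk_nhds h')

theorem tendsto_matrix_inv [DecidableEq ι] {α : Type*} {l : Filter α} {A : α → Matrix ι ι ℝ}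
    {B : Matrix ι ι ℝ} (h : Tendsto A l (𝓝 B)) (hB : IsUnit B) :
    Tendsto (fun a => (A a)⁻¹) l (𝓝 B⁻¹) := by
  have hdet : IsUnit B.det := (Matrix.isUnit_iff_isUnit_det B).1 hB
  have hc : ContinuousAt Ring.inverse B.det := by
    obtain ⟨u, hu⟩ := hdet
    rw [← hu]; exact NormedRing.inverse_continuousAt u
  exact (continuousAt_matrix_inv B hc).tendsto.comp h

end PSD

namespace Setup

variable {p m q L r : ℕ} (S : Setup p m q L r)

/-! ### The Riccati map -/

/-- One step of the filter, as a map on posterior error covariances. -/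
noncomputable def riccatiStep (P : Matrix (Fin r) (Fin r) ℝ) : Matrix (Fin r) (Fin r) ℝ :=
  (1 - S.gain (S.priorCov P) * S.Fcur) * S.priorCov P

/-- The covariance of the innovation. -/
noncomputable def innovCov (P : Matrix (Fin r) (Fin r) ℝ) : Matrix (Sig p m q) (Sig p m q) ℝ :=
  S.Fcur * S.priorCov P * S.Fcurᵀ + S.Sn

/-- The posterior error covariance that results from the gain `K`. -/
noncomputable def joseph (K : Matrix (Fin r) (Sig p m q) ℝ) (P : Matrix (Fin r) (Fin r) ℝ) :
    Matrix (Fin r) (Fin r) ℝ :=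
  (1 - K * S.Fcur) * S.priorCov P * (1 - K * S.Fcur)ᵀ + K * S.Sn * Kᵀ

theorem postCov_eq_iterate (P₀ : Matrix (Fin r) (Fin r) ℝ) (k : ℕ) :
    S.postCov P₀ k = S.riccatiStep^[k] P₀ := by
  induction k with
  | zero => rfl
  | succ k ih => rw [Function.iterate_succ_apply', ← ih]; rfl

theorem priorCov_eq (P : Matrix (Fin r) (Fin r) ℝ) :
    S.priorCov P = S.Ep * P * S.Epᵀ + S.Q := by
  simp [priorCov, Q, add_assoc]

theorem innovCov_eq (P : Matrix (Fin r) (Fin r) ℝ) :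
    S.innovCov P = S.A * P * S.Aᵀ + S.R := by
  simp only [innovCov, priorCov_eq, A, R, Matrix.mul_add, Matrix.add_mul, transpose_mul,
    Matrix.mul_assoc, add_assoc]

theorem Fcur_mul_priorCov (P : Matrix (Fin r) (Fin r) ℝ) :
    S.Fcur * S.priorCov P = S.A * P * S.Epᵀ + S.T := by
  simp only [priorCov_eq, A, T, Matrix.mul_add, Matrix.mul_assoc]

variable {S} {P : Matrix (Fin r) (Fin r) ℝ}

theorem priorCov_posSemidef (hQ : S.Q.PosSemidef) (hP : P.PosSemidef) :
    (S.priorCov P).PosSemidef := by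
  rw [priorCov_eq]; exact (PosSemidef.mul_mul_transpose hP _).add hQ

theorem innovCov_posDef (hR : S.R.PosDef) (hP : P.PosSemidef) : (S.innovCov P).PosDef := by
  rw [innovCov_eq]; exact Matrix.PosDef.posSemidef_add (PosSemidef.mul_mul_transpose hP _) hR

theorem gain_mul_innovCov (hR : S.R.PosDef) (hP : P.PosSemidef) :
    S.gain (S.priorCov P) * S.innovCov P = S.priorCov P * S.Fcurᵀ := by
  have h := (Matrix.isUnit_iff_isUnit_det _).1 (innovCov_posDef hR hP).isUnit
  exact Matrix.nonsing_inv_mul_cancel_right _ _ h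

theorem innovCov_mul_gain_transpose (hQ : S.Q.PosSemidef) (hR : S.R.PosDef) (hP : P.PosSemidef) :
    S.innovCov P * (S.gain (S.priorCov P))ᵀ = S.Fcur * S.priorCov P := by
  have h := congrArg transpose (gain_mul_innovCov hR hP)
  rwa [transpose_mul, transpose_mul, transpose_transpose,
    PosSemidef.transpose_eq (innovCov_posDef hR hP).posSemidef,
    PosSemidef.transpose_eq (priorCov_posSemidef hQ hP)] at h

theorem N_eq (hQ : S.Q.PosSemidef) (hP : P.PosSemidef) :
    S.N P = S.gain (S.priorCov P) * S.Fcur * S.priorCov P := by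
  have h := Fcur_mul_priorCov S P
  rw [N, ← innovCov_eq, ← h, transpose_mul, PosSemidef.transpose_eq (priorCov_posSemidef hQ hP)]
  simp only [gain, innovCov, Matrix.mul_assoc]

/-- This form shows that `N` is the covariance of the correction, gain times innovation; `N_eq`
shows it as the amount that the correction removes from the prior covariance. -/
theorem N_eq_gain_mul_innovCov (hQ : S.Q.PosSemidef) (hR : S.R.PosDef) (hP : P.PosSemidef) :
    S.N P = S.gain (S.priorCov P) * S.innovCov P * (S.gain (S.priorCov P))ᵀ := by
  rw [N_eq hQ hP, Matrix.mul_assoc _ (S.innovCov P), innovCov_mul_gain_transpose hQ hR hP,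
    Matrix.mul_assoc]

theorem N_posSemidef (hQ : S.Q.PosSemidef) (hR : S.R.PosDef) (hP : P.PosSemidef) :
    (S.N P).PosSemidef := by
  rw [N_eq_gain_mul_innovCov hQ hR hP]
  exact PosSemidef.mul_mul_transpose (innovCov_posDef hR hP).posSemidef _

theorem riccatiStep_eq (hQ : S.Q.PosSemidef) (hP : P.PosSemidef) :
    S.riccatiStep P = S.Ep * P * S.Epᵀ - S.N P + S.Q := by
  rw [riccatiStep, N_eq hQ hP, Matrix.sub_mul, Matrix.one_mul]
  nth_rw 1 [priorCov_eq]
  abel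

theorem riccatiStep_fixed_iff (hQ : S.Q.PosSemidef) :
    S.SolvesARE P ↔ P.PosSemidef ∧ S.riccatiStep P = P := by
  constructor
  · rintro ⟨h, h'⟩; exact ⟨h, by rw [riccatiStep_eq hQ h]; exact h'.symm⟩
  · rintro ⟨h, h'⟩; refine ⟨h, ?_⟩; rw [riccatiStep_eq hQ h] at h'; exact h'.symm

/-- Completion of the square in the gain: the excess over the optimal gain is a congruence of the
innovation covariance, hence positive semidefinite. -/
theorem joseph_sub_riccatiStep (hQ : S.Q.PosSemidef) (hR : S.R.PosDef)
    (hP : P.PosSemidef) (K : Matrix (Fin r) (Sig p m q) ℝ) :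
    S.joseph K P - S.riccatiStep P =
      (K - S.gain (S.priorCov P)) * S.innovCov P * (K - S.gain (S.priorCov P))ᵀ := by
  have h1 := gain_mul_innovCov hR hP
  have h2 := innovCov_mul_gain_transpose hQ hR hP
  have h3 : K * S.innovCov P * Kᵀ =
      K * S.Fcur * S.priorCov P * S.Fcurᵀ * Kᵀ + K * S.Sn * Kᵀ := by
    simp only [innovCov, Matrix.mul_add, Matrix.add_mul, Matrix.mul_assoc]
  rw [transpose_sub, Matrix.sub_mul, Matrix.sub_mul, h1, Matrix.mul_sub, Matrix.mul_sub, h3,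
    Matrix.mul_assoc K (S.innovCov P), h2]
  have h4 : S.priorCov P * S.Fcurᵀ * (S.gain (S.priorCov P))ᵀ =
      S.gain (S.priorCov P) * (S.Fcur * S.priorCov P) := by
    rw [← h1, Matrix.mul_assoc, h2]
  rw [h4, joseph, riccatiStep, transpose_sub, transpose_one, transpose_mul]
  simp only [Matrix.mul_sub, Matrix.sub_mul, Matrix.mul_one, Matrix.one_mul, Matrix.mul_assoc]
  abel

theorem riccatiStep_le_joseph (hQ : S.Q.PosSemidef) (hR : S.R.PosDef) (hP : P.PosSemidef)
    (K : Matrix (Fin r) (Sig p m q) ℝ) : S.riccatiStep P ≤ S.joseph K P := by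
  rw [Matrix.le_iff, joseph_sub_riccatiStep hQ hR hP]
  exact PosSemidef.mul_mul_transpose (innovCov_posDef hR hP).posSemidef _

theorem riccatiStep_eq_joseph (hQ : S.Q.PosSemidef) (hR : S.R.PosDef) (hP : P.PosSemidef) :
    S.riccatiStep P = S.joseph (S.gain (S.priorCov P)) P := by
  have := joseph_sub_riccatiStep hQ hR hP (S.gain (S.priorCov P))
  simp only [sub_self, Matrix.zero_mul] at this
  exact (sub_eq_zero.1 this).symm

theorem joseph_mono (K : Matrix (Fin r) (Sig p m q) ℝ) : Monotone (S.joseph K) := by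
  intro P P' h
  refine add_le_add_left (mul_mul_transpose_mono ?_ _) _
  rw [priorCov_eq, priorCov_eq]
  exact add_le_add_left (mul_mul_transpose_mono h _) _

/-- For a fixed gain the update is monotone, and the Riccati map is the minimum over gains. The gain
that is optimal for the larger covariance serves both. -/
theorem riccatiStep_mono (hQ : S.Q.PosSemidef) (hR : S.R.PosDef)
    {P' : Matrix (Fin r) (Fin r) ℝ} (hP : P.PosSemidef) (hP' : P'.PosSemidef) (h : P ≤ P') :
    S.riccatiStep P ≤ S.riccatiStep P' :=
  (riccatiStep_le_joseph hQ hR hP _).trans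
    ((joseph_mono _ h).trans_eq (riccatiStep_eq_joseph hQ hR hP').symm)

theorem riccatiStep_posSemidef (hQ : S.Q.PosSemidef) (hSn : S.Sn.PosSemidef) (hR : S.R.PosDef)
    (hP : P.PosSemidef) : (S.riccatiStep P).PosSemidef := by
  rw [riccatiStep_eq_joseph hQ hR hP]
  exact (PosSemidef.mul_mul_transpose (priorCov_posSemidef hQ hP) _).add
    (PosSemidef.mul_mul_transpose hSn _)

theorem iterate_posSemidef (hQ : S.Q.PosSemidef) (hSn : S.Sn.PosSemidef) (hR : S.R.PosDef)
    (hP : P.PosSemidef) (k : ℕ) : (S.riccatiStep^[k] P).PosSemidef := by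
  induction k with
  | zero => exact hP
  | succ k ih => rw [Function.iterate_succ_apply']; exact riccatiStep_posSemidef hQ hSn hR ih

theorem iterate_mono (hQ : S.Q.PosSemidef) (hSn : S.Sn.PosSemidef) (hR : S.R.PosDef)
    {P' : Matrix (Fin r) (Fin r) ℝ} (hP : P.PosSemidef) (hP' : P'.PosSemidef) (h : P ≤ P')
    (k : ℕ) : S.riccatiStep^[k] P ≤ S.riccatiStep^[k] P' := by
  induction k with
  | zero => exact h
  | succ k ih =>
    rw [Function.iterate_succ_apply', Function.iterate_succ_apply']
    exact riccatiStep_mono hQ hR (iterate_posSemidef hQ hSn hR hP k)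
      (iterate_posSemidef hQ hSn hR hP' k) ih

/-- Positive definiteness of `S.R` keeps the innovation covariance invertible at the limit, where
matrix inversion is then continuous. -/
theorem tendsto_N {α : Type*} {l : Filter α} {A : α → Matrix (Fin r) (Fin r) ℝ}
    (hR : S.R.PosDef) (hP : P.PosSemidef) (h : Tendsto A l (𝓝 P)) :
    Tendsto (fun a => S.N (A a)) l (𝓝 (S.N P)) := by
  have h1 : Tendsto (fun a => S.A * A a * S.Epᵀ + S.T) l (𝓝 (S.A * P * S.Epᵀ + S.T)) := by
    have : Continuous fun M : Matrix (Fin r) (Fin r) ℝ => S.A * M * S.Epᵀ + S.T := by fun_prop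
    exact (this.tendsto P).comp h
  have h2 : Tendsto (fun a => S.A * A a * S.Aᵀ + S.R) l (𝓝 (S.A * P * S.Aᵀ + S.R)) := by
    have : Continuous fun M : Matrix (Fin r) (Fin r) ℝ => S.A * M * S.Aᵀ + S.R := by fun_prop
    exact (this.tendsto P).comp h
  have h3 := tendsto_matrix_inv h2 (by rw [← innovCov_eq]; exact (innovCov_posDef hR hP).isUnit)
  have h4 : Tendsto (fun a => (S.A * A a * S.Epᵀ + S.T)ᵀ) l (𝓝 (S.A * P * S.Epᵀ + S.T)ᵀ) :=
    ((continuous_id.matrix_transpose).tendsto _).comp h1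
  exact tendsto_matrix_mul (tendsto_matrix_mul h4 h3) h1

theorem tendsto_riccatiStep {α : Type*} {l : Filter α} {A : α → Matrix (Fin r) (Fin r) ℝ}
    (hQ : S.Q.PosSemidef) (hR : S.R.PosDef) (hP : P.PosSemidef) (hA : ∀ a, (A a).PosSemidef)
    (h : Tendsto A l (𝓝 P)) :
    Tendsto (fun a => S.riccatiStep (A a)) l (𝓝 (S.riccatiStep P)) := by
  simp_rw [fun a => riccatiStep_eq hQ (hA a), riccatiStep_eq hQ hP]
  have h1 : Tendsto (fun a => S.Ep * A a * S.Epᵀ) l (𝓝 (S.Ep * P * S.Epᵀ)) := by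
    have : Continuous fun M : Matrix (Fin r) (Fin r) ℝ => S.Ep * M * S.Epᵀ := by fun_prop
    exact (this.tendsto P).comp h
  exact (h1.sub (tendsto_N hR hP h)).add_const _

end Setup
end ProbGain

namespace ProbGain

/-! ### Behaviors -/

section Behavior

variable {p m q L r : ℕ} {B : Set (Traj p m q)}

/-- A law of order at most `L` only sees windows of `L + 1` samples, so trajectories can be glued
from admissible segments. -/
theorem IsLTIBehavior.mem_of_segment_mem (hB : IsLTIBehavior L B) {w : Traj p m q}
    (h : ∀ k, segment L w k ∈ restricted L B) : w ∈ B := by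
  obtain ⟨s, R, rfl⟩ := hB
  intro k
  obtain ⟨w', hw', j, hj⟩ := h k
  have : ∀ i : Fin (L + 1), w (k + i) = w' (j + i) := fun i => by
    funext a; exact congrFun hj (i, a)
  simp_rw [this]
  exact hw' j

variable {S : Setup p m q L r}

theorem Setup.Represents.exists_mulVec (hF : S.Represents B) {w : Traj p m q} (hw : w ∈ B)
    (k : ℕ) : ∃ g, S.F *ᵥ g = segment L w k := by
  have : segment L w k ∈ Set.range S.F.mulVec := hF.2 ▸ ⟨w, hw, k, rfl⟩
  exact this

theorem Setup.Represents.mulVec_mem (hF : S.Represents B) (g : Fin r → ℝ) :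
    S.F *ᵥ g ∈ restricted L B := hF.2 ▸ ⟨g, rfl⟩

end Behavior

/-! ### Continuation of segments as a state-space system -/

namespace Setup

variable {p m q L r : ℕ} (S : Setup p m q L r)

theorem Fcur_mulVec (g : Fin r → ℝ) (a) : (S.Fcur *ᵥ g) a = (S.F *ᵥ g) (Fin.last L, a) := rfl
theorem Fu_mulVec (g : Fin r → ℝ) (a) : (S.Fu *ᵥ g) a = (S.Fcur *ᵥ g) (.inr (.inl a)) := rfl
theorem Fdk_mulVec (g : Fin r → ℝ) (a) : (S.Fdk *ᵥ g) a = (S.Fcur *ᵥ g) (.inr (.inr a)) := rfl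
theorem Fwp_mulVec (g : Fin r → ℝ) (i a) : (S.Fwp *ᵥ g) (i, a) = (S.F *ᵥ g) (i.castSucc, a) := rfl
theorem PipF_mulVec (g : Fin r → ℝ) (i a) : (S.PipF *ᵥ g) (i, a) = (S.F *ᵥ g) (i.succ, a) := rfl

/-- `g'` is the parameter of a segment that continues the one of `g` with inputs `u` and `d`. -/
structure IsSuccessor (g : Fin r → ℝ) (u : Fin m → ℝ) (d : Fin q → ℝ) (g' : Fin r → ℝ) :
    Prop where
  past : S.Fwp *ᵥ g' = S.PipF *ᵥ g
  control : S.Fu *ᵥ g' = u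
  disturbance : S.Fdk *ᵥ g' = d

/-- The parameter of the next segment. -/
noncomputable def advance (g : Fin r → ℝ) (u : Fin m → ℝ) (d : Fin q → ℝ) : Fin r → ℝ :=
  S.Ep *ᵥ g + S.Ef *ᵥ d + S.Eu *ᵥ u

variable {S} {B : Set (Traj p m q)}

/-- The segment of `g` lies on a trajectory; freeness of the input allows a new input right after
the segment without changing its past. The shifted window of the new trajectory is the successor. -/
theorem exists_isSuccessor (hio : IsInputOutput B) (hF : S.Represents B)
    (g : Fin r → ℝ) (u : Fin m → ℝ) (d : Fin q → ℝ) : ∃ g', S.IsSuccessor g u d g' := by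
  obtain ⟨w, hw, k, hk⟩ := hF.mulVec_mem g
  obtain ⟨w', hw', hpast, hin⟩ := hio.free w hw (k + L + 1)
    (fun j => if j < k + L + 1 then inputPart (w j) else Sum.elim u d)
    (fun j hj => if_pos hj)
  obtain ⟨g', hg'⟩ := hF.exists_mulVec hw' (k + 1)
  have hlast := hin (k + L + 1)
  rw [if_neg (lt_irrefl _)] at hlast
  have hcur : ∀ a, (S.Fcur *ᵥ g') a = w' (k + L + 1) a := fun a => by
    rw [Fcur_mulVec, hg', segment, Fin.val_last, add_right_comm]
  refine ⟨g', ?_, ?_, ?_⟩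
  · funext ⟨i, a⟩
    rw [Fwp_mulVec, PipF_mulVec, hg', hk, segment, segment]
    have : k + 1 + (i.castSucc : ℕ) = k + (i.succ : ℕ) := by simp; omega
    simp only [this]
    rw [hpast]
    have := i.2
    simp only [Fin.val_succ]; omega
  · funext a
    rw [Fu_mulVec, hcur]
    exact congrFun hlast (.inl a)
  · funext a
    rw [Fdk_mulVec, hcur]
    exact congrFun hlast (.inr a)

theorem stack_mulVec (g : Fin r → ℝ) : S.stack *ᵥ g = Sum.elim (S.Fwp *ᵥ g) (S.Fdk *ᵥ g) :=
  fromRows_mulVec ..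

theorem exists_eq_add_Fz (hFz : S.IsVirtualInputBasis) (g : Fin r → ℝ) :
    ∃ z, g = pinv S.stack *ᵥ (S.stack *ᵥ g) + S.Fz *ᵥ z := by
  obtain ⟨z, hz⟩ : (1 - pinv S.stack * S.stack) *ᵥ g ∈ Set.range S.Fz.mulVec :=
    hFz.2 ▸ ⟨g, rfl⟩
  refine ⟨z, ?_⟩
  have hz' : S.Fz *ᵥ z = _ := hz
  rw [hz', sub_mulVec, one_mulVec, mulVec_mulVec, add_sub_cancel]

/-- From the zero segment with `d = 0`, every `u` can be reached. Such a successor has zero past and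
zero disturbance, so it lies in the range of `Fz`; thus `Fu * Fz` is surjective. -/
theorem isUnit_Fu_mul_Fz (hio : IsInputOutput B) (hF : S.Represents B)
    (hFz : S.IsVirtualInputBasis) : IsUnit (S.Fu * S.Fz) := by
  refine mulVec_surjective_iff_isUnit.1 fun u => ?_
  obtain ⟨g, h1, h2, h3⟩ := exists_isSuccessor hio hF 0 u 0
  obtain ⟨z, hz⟩ := exists_eq_add_Fz hFz g
  rw [stack_mulVec, h1, h3, mulVec_zero, Sum.elim_zero_zero, mulVec_zero, zero_add] at hz
  exact ⟨z, by rw [← mulVec_mulVec, ← hz, h2]⟩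

theorem pinv_stack_mulVec (g : Fin r → ℝ) (d : Fin q → ℝ) :
    pinv S.stack *ᵥ Sum.elim (S.PipF *ᵥ g) d = S.Fp *ᵥ g + S.Ff *ᵥ d := by
  have hFp : S.Fp *ᵥ g = pinv S.stack *ᵥ (fromRows S.PipF 0 *ᵥ g) :=
    (mulVec_mulVec g (pinv S.stack) (fromRows S.PipF 0)).symm
  have hFf : S.Ff *ᵥ d = pinv S.stack *ᵥ (fromRows 0 1 *ᵥ d) :=
    (mulVec_mulVec d (pinv S.stack) (fromRows 0 1)).symm
  rw [hFp, hFf, ← mulVec_add, fromRows_mulVec, fromRows_mulVec]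
  congr 1
  ext (i | i) <;> simp

/-- The projection `1 - Eu * Fu` annihilates the range of `Fz`, and `Eu` restores the part carried
by `u`. The virtual input may thus be traded for the actual one. -/
theorem add_Fz_eq_advance (hu : IsUnit (S.Fu * S.Fz)) (g : Fin r → ℝ) (d : Fin q → ℝ)
    (z : Fin m → ℝ) :
    S.Fp *ᵥ g + S.Ff *ᵥ d + S.Fz *ᵥ z =
      S.advance g (S.Fu *ᵥ (S.Fp *ᵥ g + S.Ff *ᵥ d + S.Fz *ᵥ z)) d := by
  have hdet := (Matrix.isUnit_iff_isUnit_det _).1 hu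
  have : S.Fz * ((S.Fu * S.Fz)⁻¹ * (S.Fu * S.Fz)) = S.Fz := by
    rw [nonsing_inv_mul _ hdet, Matrix.mul_one]
  rw [advance, Ep, Ef, Eu]
  simp only [mulVec_add, mulVec_mulVec, Matrix.sub_mul, Matrix.one_mul, sub_mulVec,
    Matrix.mul_assoc, this]
  abel

theorem IsSuccessor.eq_advance (hu : IsUnit (S.Fu * S.Fz)) (hFz : S.IsVirtualInputBasis)
    {g g' : Fin r → ℝ} {u : Fin m → ℝ} {d : Fin q → ℝ} (h : S.IsSuccessor g u d g') :
    g' = S.advance g u d := by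
  obtain ⟨z, hz⟩ := exists_eq_add_Fz hFz g'
  rw [stack_mulVec, h.past, h.disturbance, pinv_stack_mulVec] at hz
  have := add_Fz_eq_advance hu g d z
  rwa [← hz, h.control] at this

theorem isSuccessor_advance (hio : IsInputOutput B) (hF : S.Represents B)
    (hFz : S.IsVirtualInputBasis) (g : Fin r → ℝ) (u : Fin m → ℝ) (d : Fin q → ℝ) :
    S.IsSuccessor g u d (S.advance g u d) := by
  obtain ⟨g', hg'⟩ := exists_isSuccessor hio hF g u d
  rwa [hg'.eq_advance (isUnit_Fu_mul_Fz hio hF hFz) hFz] at hg'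

theorem Fwp_mulVec_Ep_mulVec (hio : IsInputOutput B) (hF : S.Represents B)
    (hFz : S.IsVirtualInputBasis) (g : Fin r → ℝ) :
    S.Fwp *ᵥ (S.Ep *ᵥ g) = S.PipF *ᵥ g := by
  simpa [advance] using (isSuccessor_advance hio hF hFz g 0 0).past

/-! ### Convergence of the error covariance -/

section Convergence

open scoped MatrixOrder Topology

variable {P : Matrix (Fin r) (Fin r) ℝ}

/-- Every estimator can be driven to an error covariance that no longer depends on the initial one
in `L + 1` steps. -/
theorem exists_iterate_le (hio : IsInputOutput B) (hF : S.Represents B)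
    (hFz : S.IsVirtualInputBasis) (hQ : S.Q.PosSemidef) (hSn : S.Sn.PosSemidef) (hR : S.R.PosDef) :
    ∃ C : Matrix (Fin r) (Fin r) ℝ, C.PosSemidef ∧
      ∀ P : Matrix (Fin r) (Fin r) ℝ, P.PosSemidef → S.riccatiStep^[L + 1] P ≤ C := by
  -- `Θ` transports the initial error through `j` steps, and `C` collects the noise. The invariant
  -- is that the segments in the range of `F * Θ` vanish on their last `j` samples.
  have key : ∀ j : ℕ, ∃ Θ C : Matrix (Fin r) (Fin r) ℝ, C.PosSemidef ∧
      (∀ (v : Fin r → ℝ) (i : Fin (L + 1)) (a), L < i + j → (S.F *ᵥ (Θ *ᵥ v)) (i, a) = 0) ∧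
      ∀ P : Matrix (Fin r) (Fin r) ℝ, P.PosSemidef →
        S.riccatiStep^[j] P ≤ Θ * P * Θᵀ + C := by
    intro j
    induction j with
    | zero =>
      refine ⟨1, 0, .zero, fun v i a hi => absurd i.2 (by omega), fun P _ => by simp⟩
    | succ j ih =>
      obtain ⟨Θ, C, hC, hΘ, hle⟩ := ih
      set G : Matrix (Fin r) (Fin r) ℝ := S.Ep * Θ with hG
      set H := pinv (S.Fcur * G) with hH
      -- With this gain the transported error becomes `G * (1 - H * Fcur * G)`; its current sample
      -- vanishes by a Penrose equation, and its earlier samples are shifts of ones already zero.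
      set K := G * H with hK
      have hKG : (1 - K * S.Fcur) * G = G * (1 - H * S.Fcur * G) := by
        simp only [hK, Matrix.sub_mul, Matrix.mul_sub, Matrix.one_mul, Matrix.mul_one,
          Matrix.mul_assoc]
      have hcur : S.Fcur * (G * (1 - H * S.Fcur * G)) = 0 := by
        have := (pinv_spec (S.Fcur * G)).mul_mul
        rw [← Matrix.mul_assoc, Matrix.mul_sub, Matrix.mul_one, Matrix.mul_assoc H,
          ← Matrix.mul_assoc (S.Fcur * G), this, sub_self]
      refine ⟨(1 - K * S.Fcur) * G, S.joseph K C, ?_, fun v i a hi => ?_, fun P hP => ?_⟩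
      · exact (PosSemidef.mul_mul_transpose (priorCov_posSemidef hQ hC) _).add
          (PosSemidef.mul_mul_transpose hSn _)
      · rw [hKG]
        rcases Fin.eq_castSucc_or_eq_last i with ⟨i, rfl⟩ | rfl
        · rw [← Fwp_mulVec, ← mulVec_mulVec, hG, ← mulVec_mulVec _ S.Ep,
            Fwp_mulVec_Ep_mulVec hio hF hFz, PipF_mulVec]
          refine hΘ _ _ _ ?_
          simp only [Fin.val_succ, Fin.val_castSucc] at hi ⊢
          omega
        · rw [← Fcur_mulVec, mulVec_mulVec, hcur]; simp
      · rw [Function.iterate_succ_apply']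
        have hj := iterate_posSemidef hQ hSn hR hP j
        refine (riccatiStep_le_joseph hQ hR hj K).trans ((joseph_mono K (hle P hP)).trans_eq ?_)
        simp only [joseph, priorCov_eq, hG, transpose_mul, Matrix.mul_add, Matrix.add_mul,
          Matrix.mul_assoc]
        abel
  obtain ⟨Θ, C, hC, hΘ, hle⟩ := key (L + 1)
  refine ⟨C, hC, fun P hP => ?_⟩
  have : Θ = 0 := by
    refine Matrix.ext_of_mulVec_single fun i => hF.1 ?_
    rw [zero_mulVec, mulVec_zero]
    funext ⟨j, a⟩
    exact hΘ _ j a (by omega)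
  simpa [this] using hle P hP

/-- Monotonicity makes the iterates from `0` increase and stay below the fixed point `P`; their
limit is again a positive semidefinite fixed point, and there is only one. -/
theorem tendsto_iterate_zero (hQ : S.Q.PosSemidef) (hSn : S.Sn.PosSemidef)
    (hR : S.R.PosDef) (hP : S.IsTheARESolution P) :
    Tendsto (fun k => S.riccatiStep^[k] 0) atTop (𝓝 P) := by
  have hfix := (riccatiStep_fixed_iff hQ).1 hP.1
  have h0 := fun k => iterate_posSemidef (P := 0) hQ hSn hR .zero k
  have hmono : Monotone fun k => S.riccatiStep^[k] 0 := monotone_nat_of_le_succ fun k => by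
    rw [Function.iterate_succ_apply]
    have := riccatiStep_posSemidef hQ hSn hR .zero
    exact iterate_mono hQ hSn hR .zero this this.nonneg k
  have hle : ∀ k, S.riccatiStep^[k] 0 ≤ P := fun k => by
    have := iterate_mono hQ hSn hR .zero hfix.1 hfix.1.nonneg k
    rwa [Function.iterate_fixed hfix.2] at this
  obtain ⟨M, hM⟩ := exists_tendsto_of_monotone (fun k => PosSemidef.transpose_eq (h0 k)) hmono hle
  have hM0 := posSemidef_of_tendsto hM h0
  have h1 := tendsto_riccatiStep hQ hR hM0 h0 hM
  simp_rw [← Function.iterate_succ_apply' S.riccatiStep] at h1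
  have h2 : S.riccatiStep M = M := tendsto_nhds_unique h1 (hM.comp (tendsto_add_atTop_nat 1))
  rwa [← hP.2 M ((riccatiStep_fixed_iff hQ).2 ⟨hM0, h2⟩)]

/-- The error covariance converges to the solution of the Riccati equation. -/
theorem tendsto_postCov (hio : IsInputOutput B) (hF : S.Represents B)
    (hFz : S.IsVirtualInputBasis) (hQ : S.Q.PosSemidef) (hSn : S.Sn.PosSemidef) (hR : S.R.PosDef)
    (hP : S.IsTheARESolution P) {P₀ : Matrix (Fin r) (Fin r) ℝ} (hP₀ : P₀.PosSemidef) :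
    Tendsto (S.postCov P₀) atTop (𝓝 P) := by
  have hfix := (riccatiStep_fixed_iff hQ).1 hP.1
  obtain ⟨C, hC, hCle⟩ := exists_iterate_le hio hF hFz hQ hSn hR
  have hC0 := fun k => iterate_posSemidef hQ hSn hR hC k
  have hanti : Antitone fun k => S.riccatiStep^[(L + 1) * k] C :=
    antitone_nat_of_succ_le fun k => by
      rw [Nat.mul_succ, Function.iterate_add_apply]
      exact iterate_mono hQ hSn hR (hC0 _) hC (hCle C hC) _
  obtain ⟨M, hM⟩ := exists_tendsto_of_antitone (fun k => hC0 _) hanti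
  have hM0 := posSemidef_of_tendsto hM fun k => hC0 _
  have hiter : ∀ j, Tendsto (fun k => S.riccatiStep^[j + (L + 1) * k] C) atTop
      (𝓝 (S.riccatiStep^[j] M)) := by
    intro j
    induction j with
    | zero => simpa using hM
    | succ j ih =>
      have := tendsto_riccatiStep hQ hR (iterate_posSemidef hQ hSn hR hM0 j) (fun k => hC0 _) ih
      simp_rw [← Function.iterate_succ_apply' S.riccatiStep] at this
      simpa only [Nat.succ_eq_add_one, add_right_comm] using this
  have hMfix : S.riccatiStep^[L + 1] M = M := by
    refine tendsto_nhds_unique (hiter (L + 1)) ((hM.comp (tendsto_add_atTop_nat 1)).congr fun k => ?_)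
    simp only [Function.comp_apply]; congr 2; ring
  -- So far `M` is fixed only by the `(L+1)`-fold step. It is the largest such fixed point, and
  -- comparing it with `riccatiStep M`, another one, shows that a single step already fixes it.
  have hle_M : ∀ P' : Matrix (Fin r) (Fin r) ℝ, P'.PosSemidef → S.riccatiStep^[L + 1] P' = P' →
      P' ≤ M := by
    intro P' hP' hfix'
    have h1 : ∀ k, P' ≤ S.riccatiStep^[(L + 1) * k] C := fun k => by
      have h2 : P' ≤ C := hfix' ▸ hCle P' hP'
      have h3 := iterate_mono hQ hSn hR hP' hC h2 ((L + 1) * k)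
      have h4 : S.riccatiStep^[(L + 1) * k] P' = P' := by
        rw [Function.iterate_mul, Function.iterate_fixed hfix']
      rwa [h4] at h3
    rw [Matrix.le_iff]
    exact posSemidef_of_tendsto (hM.sub_const P') fun k => Matrix.le_iff.1 (h1 k)
  have hfM := riccatiStep_posSemidef hQ hSn hR hM0
  have h1 : S.riccatiStep M ≤ M := hle_M _ hfM (by
    rw [← Function.iterate_succ_apply, Function.iterate_succ_apply', hMfix])
  have h2 : M ≤ S.riccatiStep M := by
    have h3 : ∀ j, S.riccatiStep^[j + 1] M ≤ S.riccatiStep M := by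
      intro j
      induction j with
      | zero => exact le_rfl
      | succ j ih =>
        rw [Function.iterate_succ_apply']
        exact (riccatiStep_mono hQ hR (iterate_posSemidef hQ hSn hR hM0 _) hfM ih).trans
          (riccatiStep_mono hQ hR hfM hM0 h1)
    have := h3 L
    rwa [hMfix] at this
  have hMP : M = P := hP.2 M ((riccatiStep_fixed_iff hQ).2 ⟨hM0, le_antisymm h1 h2⟩)
  have hupper : Tendsto (fun k => S.riccatiStep^[k] C) atTop (𝓝 P) := by
    have hk : ∀ k, S.riccatiStep^[k] C ≤ S.riccatiStep^[k % (L + 1) + (L + 1) * (k / (L + 1))] C :=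
      fun k => by rw [Nat.mod_add_div]
    have hj : ∀ j, Tendsto (fun k => S.riccatiStep^[j + (L + 1) * (k / (L + 1))] C) atTop
        (𝓝 P) := fun j => by
      have := (hiter j).comp (Nat.tendsto_div_const_atTop (Nat.succ_ne_zero L))
      rwa [hMP, Function.iterate_fixed hfix.2] at this
    refine tendsto_nhds.2 fun s hs hPs => ?_
    -- Convergence holds along each of the finitely many residue classes modulo `L + 1`, hence along
    -- all `k`.
    have h4 : ∀ᶠ k in atTop, ∀ j : Fin (L + 1),
        S.riccatiStep^[j + (L + 1) * (k / (L + 1))] C ∈ s :=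
      eventually_all.2 fun j => (hj j).eventually (hs.mem_nhds hPs)
    filter_upwards [h4] with k hk
    have := hk ⟨k % (L + 1), Nat.mod_lt _ (Nat.succ_pos L)⟩
    rwa [Nat.mod_add_div] at this
  have hshift : Tendsto (fun k => S.riccatiStep^[k + (L + 1)] P₀) atTop (𝓝 P) := by
    refine tendsto_squeeze (fun k => PosSemidef.transpose_eq (iterate_posSemidef hQ hSn hR hP₀ _))
      (PosSemidef.transpose_eq hfix.1)
      ((tendsto_iterate_zero hQ hSn hR hP).comp (tendsto_add_atTop_nat (L + 1))) hupper
      (fun k => iterate_mono hQ hSn hR .zero hP₀ hP₀.nonneg _) fun k => ?_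
    rw [Function.iterate_add_apply]
    exact iterate_mono hQ hSn hR (iterate_posSemidef hQ hSn hR hP₀ _) hC (hCle P₀ hP₀) k
  refine (tendsto_add_atTop_iff_nat (L + 1)).1 (hshift.congr fun k => ?_)
  rw [postCov_eq_iterate]

end Convergence

end Setup
end ProbGain

namespace ProbGain
namespace Setup

/-! ### The controlled system in terms of the parameterizer -/

section ClosedLoop

variable {p m q L r : ℕ} {S : Setup p m q L r} {B : Set (Traj p m q)}

theorem advance_sub_advance (g g' : Fin r → ℝ) (u u' : Fin m → ℝ) (d d' : Fin q → ℝ) :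
    S.advance g u d - S.advance g' u' d' =
      S.Ep *ᵥ (g - g') + (S.Ef *ᵥ (d - d') + S.Eu *ᵥ (u - u')) := by
  simp only [advance, mulVec_sub]
  abel

/-- The prior is `Fp x + Ff d̄ + Fz z` with `z = Y W⁻¹ x + ξ`, so it is the true dynamics run on the
estimate with the mean inputs. This is what decouples the error from the controller. -/
theorem prior_eq_advance (hu : IsUnit (S.Fu * S.Fz)) (W : Matrix (Fin r) (Fin r) ℝ)
    (Y : Matrix (Fin m) (Fin r) ℝ) (ξ : Fin m → ℝ) (dbar : Fin q → ℝ) (x : Fin r → ℝ) :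
    S.prior W Y ξ dbar x = S.advance x (S.Fu *ᵥ S.prior W Y ξ dbar x) dbar := by
  have h : S.prior W Y ξ dbar x =
      S.Fp *ᵥ x + S.Ff *ᵥ dbar + S.Fz *ᵥ ((Y * W⁻¹) *ᵥ x + ξ) := by
    simp only [prior, add_mulVec, mulVec_add, mulVec_mulVec, Matrix.mul_assoc]
    abel
  rw [h]
  exact add_Fz_eq_advance hu _ _ _

variable {Ω : Type*} {W : Matrix (Fin r) (Fin r) ℝ} {Y : Matrix (Fin m) (Fin r) ℝ}
  {ξ : Fin m → ℝ} {dbar : Fin q → ℝ} {P₀ : Matrix (Fin r) (Fin r) ℝ} {g₀ ghat₀ : Ω → Fin r → ℝ}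
  {dd : ℕ → Ω → Fin q → ℝ} {du : ℕ → Ω → Fin m → ℝ} {n : ℕ → Ω → Sig p m q → ℝ}

theorem IsControlled.exists_param (hio : IsInputOutput B) (hF : S.Represents B)
    (hFz : S.IsVirtualInputBasis) {w : ℕ → Ω → Sig p m q → ℝ}
    (hw : S.IsControlled B W Y ξ dbar P₀ g₀ ghat₀ dd du n w) :
    ∃ g : ℕ → Ω → Fin r → ℝ, g 0 = g₀ ∧ (∀ k ω, w (L + 1 + k) ω = S.Fcur *ᵥ g (k + 1) ω) ∧
      ∀ k ω, g (k + 1) ω = S.advance (g k ω) (S.Fu *ᵥ S.prior W Y ξ dbar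
        (S.posterior W Y ξ dbar P₀ (ghat₀ ω) (fun t => w t ω) (fun t => n t ω) k) + du k ω)
        (dbar + dd k ω) := by
  choose g hg using fun k ω => hF.exists_mulVec (hw.mem ω) k
  have hcur : ∀ k ω, w (L + 1 + k) ω = S.Fcur *ᵥ g (k + 1) ω := fun k ω => by
    funext a
    rw [Fcur_mulVec, hg, segment, Fin.val_last]
    have : k + 1 + L = L + 1 + k := by omega
    simp only [this]
  refine ⟨g, ?_, hcur, fun k ω => ?_⟩
  · funext ω
    exact hF.1 ((hg 0 ω).trans (hw.init ω))
  · refine IsSuccessor.eq_advance (isUnit_Fu_mul_Fz hio hF hFz) hFz ⟨?_, ?_, ?_⟩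
    · funext ⟨i, a⟩
      rw [Fwp_mulVec, PipF_mulVec, hg, hg, segment, segment]
      have : k + 1 + (i.castSucc : ℕ) = k + (i.succ : ℕ) := by simp; omega
      simp only [this]
    · funext a
      rw [Fu_mulVec, ← hcur, hw.control]
      rfl
    · funext a
      rw [Fdk_mulVec, ← hcur, hw.disturbance]
      rfl

/-- The parameter of the current segment and the posterior estimate of the controlled system. -/
noncomputable def closedLoop (S : Setup p m q L r) (W : Matrix (Fin r) (Fin r) ℝ)
    (Y : Matrix (Fin m) (Fin r) ℝ) (ξ : Fin m → ℝ) (dbar : Fin q → ℝ)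
    (P₀ : Matrix (Fin r) (Fin r) ℝ) (g₀ ghat₀ : Fin r → ℝ) (dd : ℕ → Fin q → ℝ)
    (du : ℕ → Fin m → ℝ) (n : ℕ → Sig p m q → ℝ) : ℕ → (Fin r → ℝ) × (Fin r → ℝ)
  | 0 => (g₀, ghat₀)
  | k + 1 =>
    let s := closedLoop S W Y ξ dbar P₀ g₀ ghat₀ dd du n k
    let pr := S.prior W Y ξ dbar s.2
    let g := S.advance s.1 (S.Fu *ᵥ pr + du k) (dbar + dd k)
    (g, pr + S.gain (S.priorCov (S.postCov P₀ k)) *ᵥ (S.Fcur *ᵥ g + n k - S.Fcur *ᵥ pr))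

theorem exists_isControlled (hB : IsLTIBehavior L B) (hio : IsInputOutput B)
    (hF : S.Represents B) (hFz : S.IsVirtualInputBasis) :
    ∃ w, S.IsControlled B W Y ξ dbar P₀ g₀ ghat₀ dd du n w := by
  let s : ℕ → Ω → (Fin r → ℝ) × (Fin r → ℝ) := fun k ω =>
    S.closedLoop W Y ξ dbar P₀ (g₀ ω) (ghat₀ ω) (fun t => dd t ω) (fun t => du t ω)
      (fun t => n t ω) k
  -- The initial segment fills the times `0, …, L`; later samples are the current values of the
  -- closed-loop states, the one at time `t` belonging to state `t - L`.
  let w : ℕ → Ω → Sig p m q → ℝ := fun t ω a =>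
    if h : t < L + 1 then (S.F *ᵥ g₀ ω) (⟨t, h⟩, a) else (S.Fcur *ᵥ (s (t - L) ω).1) a
  have hs : ∀ k ω, S.IsSuccessor (s k ω).1
      (S.Fu *ᵥ S.prior W Y ξ dbar (s k ω).2 + du k ω) (dbar + dd k ω) (s (k + 1) ω).1 :=
    fun k ω => isSuccessor_advance hio hF hFz _ _ _
  have hcur : ∀ k ω, w (L + 1 + k) ω = S.Fcur *ᵥ (s (k + 1) ω).1 := fun k ω => by
    funext a
    have h1 : L + 1 + k - L = k + 1 := by omega
    simp only [w, h1]
    rw [dif_neg (by omega)]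
  have hseg : ∀ k ω, segment L (fun t => w t ω) k = S.F *ᵥ (s k ω).1 := by
    intro k ω
    induction k with
    | zero =>
      funext ⟨i, a⟩
      have : 0 + (i : ℕ) = i := zero_add _
      simp only [segment, w, this, i.2, dif_pos]
      rfl
    | succ k ih =>
      funext ⟨i, a⟩
      rcases Fin.eq_castSucc_or_eq_last i with ⟨i, rfl⟩ | rfl
      · rw [← Fwp_mulVec, (hs k ω).past, PipF_mulVec, ← ih, segment, segment]
        have : k + 1 + (i.castSucc : ℕ) = k + (i.succ : ℕ) := by simp; omega
        simp only [this]
      · rw [← Fcur_mulVec, ← hcur, segment]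
        have : k + 1 + ((Fin.last L : Fin (L + 1)) : ℕ) = L + 1 + k := by simp; omega
        simp only [this]
  have hpost : ∀ k ω, S.posterior W Y ξ dbar P₀ (ghat₀ ω) (fun t => w t ω) (fun t => n t ω) k =
      (s k ω).2 := by
    intro k ω
    induction k with
    | zero => rfl
    | succ k ih => rw [posterior, ih, hcur]; rfl
  refine ⟨w, fun ω => hB.mem_of_segment_mem fun k => ?_, fun ω => hseg 0 ω, fun k ω a => ?_,
    fun k ω b => ?_⟩
  · rw [hseg]; exact hF.mulVec_mem _
  · rw [hpost, hcur, ← Fu_mulVec, (hs k ω).control]; rfl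
  · rw [hcur, ← Fdk_mulVec, (hs k ω).disturbance]; rfl

end ClosedLoop

end Setup

/-! ### Second moments of random vectors -/

section SecondMoments

variable {Ω ι κ : Type*} [MeasurableSpace Ω] {μ : Measure Ω} [Fintype ι] [Fintype κ]

/-- The matrix of second moments of two random vectors. -/
noncomputable def corr (μ : Measure Ω) (X : Ω → ι → ℝ) (Y : Ω → κ → ℝ) : Matrix ι κ ℝ :=
  of fun i j => ∫ ω, X ω i * Y ω j ∂μ

theorem memLp_mulVec {X : Ω → ι → ℝ} (hX : MemLp X 2 μ) (M : Matrix κ ι ℝ) :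
    MemLp (fun ω => M *ᵥ X ω) 2 μ :=
  (LinearMap.toContinuousLinearMap M.mulVecLin).comp_memLp' hX

theorem integrable_coord_mul {X : Ω → ι → ℝ} {Y : Ω → κ → ℝ} (hX : MemLp X 2 μ)
    (hY : MemLp Y 2 μ) (i : ι) (j : κ) : Integrable (fun ω => X ω i * Y ω j) μ :=
  (hX.eval i).integrable_mul (hY.eval j)

theorem corr_transpose {ι κ : Type*} (X : Ω → ι → ℝ) (Y : Ω → κ → ℝ) : (corr μ X Y)ᵀ = corr μ Y X := by
  ext i j
  simp only [corr, transpose_apply, of_apply, mul_comm]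

theorem corr_eq_zero_symm {ι κ : Type*} {X : Ω → ι → ℝ} {Y : Ω → κ → ℝ} (h : corr μ X Y = 0) :
    corr μ Y X = 0 := by
  rw [← corr_transpose, h, transpose_zero]

variable {X X' : Ω → ι → ℝ} {Y : Ω → κ → ℝ}

theorem corr_add_left (hX : MemLp X 2 μ) (hX' : MemLp X' 2 μ) (hY : MemLp Y 2 μ) :
    corr μ (fun ω => X ω + X' ω) Y = corr μ X Y + corr μ X' Y := by
  ext i j
  simp only [corr, of_apply, Matrix.add_apply, Pi.add_apply, add_mul]
  exact integral_add (integrable_coord_mul hX hY i j) (integrable_coord_mul hX' hY i j)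

theorem corr_sub_left (hX : MemLp X 2 μ) (hX' : MemLp X' 2 μ) (hY : MemLp Y 2 μ) :
    corr μ (fun ω => X ω - X' ω) Y = corr μ X Y - corr μ X' Y := by
  ext i j
  simp only [corr, of_apply, Matrix.sub_apply, Pi.sub_apply, sub_mul]
  exact integral_sub (integrable_coord_mul hX hY i j) (integrable_coord_mul hX' hY i j)

theorem corr_mulVec_left {ν : Type*} (hX : MemLp X 2 μ) (hY : MemLp Y 2 μ) (M : Matrix ν ι ℝ) :
    corr μ (fun ω => M *ᵥ X ω) Y = M * corr μ X Y := by
  ext i j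
  simp only [corr, of_apply, Matrix.mul_apply, mulVec, dotProduct, Finset.sum_mul, mul_assoc]
  rw [integral_finsetSum _ fun l _ => (integrable_coord_mul hX hY l j).const_mul _]
  simp_rw [integral_const_mul]

theorem corr_add_right (hX : MemLp X 2 μ) (hX' : MemLp X' 2 μ) (hY : MemLp Y 2 μ) :
    corr μ Y (fun ω => X ω + X' ω) = corr μ Y X + corr μ Y X' := by
  rw [← corr_transpose, corr_add_left hX hX' hY, transpose_add, corr_transpose, corr_transpose]

theorem corr_sub_right (hX : MemLp X 2 μ) (hX' : MemLp X' 2 μ) (hY : MemLp Y 2 μ) :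
    corr μ Y (fun ω => X ω - X' ω) = corr μ Y X - corr μ Y X' := by
  rw [← corr_transpose, corr_sub_left hX hX' hY, transpose_sub, corr_transpose, corr_transpose]

theorem corr_mulVec_right {ν : Type*} (hX : MemLp X 2 μ) (hY : MemLp Y 2 μ) (M : Matrix ν ι ℝ) :
    corr μ Y (fun ω => M *ᵥ X ω) = corr μ Y X * Mᵀ := by
  rw [← corr_transpose, corr_mulVec_left hX hY, transpose_mul, corr_transpose]

theorem corr_const_left {ι κ : Type*} {Y : Ω → κ → ℝ} (b : ι → ℝ) (hY : ∀ j, ∫ ω, Y ω j ∂μ = 0) :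
    corr μ (fun _ => b) Y = 0 := by
  ext i j
  simp [corr, integral_const_mul, hY j]

theorem integrable_quadratic (hX : MemLp X 2 μ) (M : Matrix ι ι ℝ) :
    Integrable (fun ω => X ω ⬝ᵥ (M *ᵥ X ω)) μ := by
  simp only [dotProduct]
  exact integrable_finsetSum _ fun i _ => integrable_coord_mul hX (memLp_mulVec hX M) i i

theorem integral_quadratic (hX : MemLp X 2 μ) (M : Matrix ι ι ℝ) :
    ∫ ω, X ω ⬝ᵥ (M *ᵥ X ω) ∂μ = (M * corr μ X X).trace := by
  rw [← corr_mulVec_left hX hX]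
  simp only [dotProduct, trace, diag, corr, of_apply]
  rw [integral_finsetSum _ fun i _ => integrable_coord_mul hX (memLp_mulVec hX M) i i]
  simp only [mul_comm]

theorem corr_self_posSemidef (hX : MemLp X 2 μ) : (corr μ X X).PosSemidef := by
  refine posSemidef_of_quadratic (corr_transpose X X) fun v => ?_
  have h : v ⬝ᵥ (corr μ X X *ᵥ v) = ∫ ω, X ω ⬝ᵥ (vecMulVec v v *ᵥ X ω) ∂μ := by
    rw [integral_quadratic hX, vecMulVec_mul, trace_vecMulVec, dotProduct_mulVec, dotProduct_comm]
  rw [h]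
  refine integral_nonneg fun ω => ?_
  rw [vecMulVec_mulVec, dotProduct_smul, dotProduct_comm]
  exact mul_self_nonneg _

theorem _root_.ProbabilityTheory.IndepFun.corr_eq_zero (h : IndepFun X Y μ) (hX : MemLp X 2 μ)
    (hY : MemLp Y 2 μ) (hY0 : ∀ j, ∫ ω, Y ω j ∂μ = 0) : corr μ X Y = 0 := by
  ext i j
  have hij : IndepFun (fun ω => X ω i) (fun ω => Y ω j) μ :=
    h.comp (measurable_pi_apply i) (measurable_pi_apply j)
  rw [corr, of_apply, hij.integral_fun_mul_eq_mul_integral (hX.eval i).aestronglyMeasurable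
    (hY.eval j).aestronglyMeasurable, hY0 j, mul_zero, Matrix.zero_apply]

theorem IsWhiteNoise.corr_self {v : ℕ → Ω → ι → ℝ} {C : Matrix ι ι ℝ}
    (hv : IsWhiteNoise μ v C) (k : ℕ) : corr μ (v k) (v k) = C := by
  ext i j; simp [corr, hv.cov]

theorem IsWhiteNoise.corr_of_ne {v : ℕ → Ω → ι → ℝ} {C : Matrix ι ι ℝ}
    (hv : IsWhiteNoise μ v C) {j k : ℕ} (h : j ≠ k) : corr μ (v j) (v k) = 0 := by
  ext a b; simp [corr, hv.cov, h]

theorem IsWhiteNoise.posSemidef {v : ℕ → Ω → ι → ℝ} {C : Matrix ι ι ℝ}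
    (hv : IsWhiteNoise μ v C) : C.PosSemidef :=
  hv.corr_self 0 ▸ corr_self_posSemidef (hv.memLp 0)

theorem isWhiteNoise_of_corr {v : ℕ → Ω → ι → ℝ} {C : Matrix ι ι ℝ} (h2 : ∀ k, MemLp (v k) 2 μ)
    (h0 : ∀ k a, ∫ ω, v k ω a ∂μ = 0) (hC : ∀ k, corr μ (v k) (v k) = C)
    (hne : ∀ j k, j ≠ k → corr μ (v j) (v k) = 0) : IsWhiteNoise μ v C where
  memLp := h2
  mean := h0
  cov j k a b := by
    split_ifs with h
    · subst h; exact congrFun (congrFun (hC j) a) b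
    · exact congrFun (congrFun (hne j k h) a) b

theorem integral_mulVec_eq_zero {κ : Type*} [IsFiniteMeasure μ] (hX : MemLp X 2 μ)
    (h0 : ∀ i, ∫ ω, X ω i ∂μ = 0) (M : Matrix κ ι ℝ) (j : κ) : ∫ ω, (M *ᵥ X ω) j ∂μ = 0 := by
  simp only [mulVec, dotProduct]
  rw [integral_finsetSum _ fun i _ =>
    (((hX.eval i).integrable (by norm_num)).const_mul _)]
  simp [integral_const_mul, h0]

end SecondMoments
end ProbGain

namespace ProbGain
namespace Setup

/-! ### Second moments of the filter -/

section Moments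

variable {p m q L r : ℕ} {S : Setup p m q L r} {Ω : Type*} [MeasurableSpace Ω] {μ : Measure Ω}
  [IsProbabilityMeasure μ]

/-- The second moments of the estimate `x` and its error `e` before step `k`: the error has mean
zero and covariance `P`, it is uncorrelated with the estimate, and both are uncorrelated with the
process noise `η` and the measurement noise `n` of all later steps. -/
structure FilterMoments (μ : Measure Ω) (P : Matrix (Fin r) (Fin r) ℝ) (x e : Ω → Fin r → ℝ)
    (η : ℕ → Ω → Fin r → ℝ) (n : ℕ → Ω → Sig p m q → ℝ) (k : ℕ) : Prop where
  memLp_x : MemLp x 2 μ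
  memLp_e : MemLp e 2 μ
  mean_e : ∀ i, ∫ ω, e ω i ∂μ = 0
  cov_e : corr μ e e = P
  x_e : corr μ x e = 0
  x_η : ∀ j, k ≤ j → corr μ x (η j) = 0
  e_η : ∀ j, k ≤ j → corr μ e (η j) = 0
  x_n : ∀ j, k ≤ j → corr μ x (n j) = 0
  e_n : ∀ j, k ≤ j → corr μ e (n j) = 0

/-- The optimal gain makes the correction `ν` the orthogonal projection of the prior error `pe` on
the innovation, so `corr ν pe = corr ν ν = N`. Everything else is bilinearity and the absence of
correlation with later noise. -/
theorem FilterMoments.step {P : Matrix (Fin r) (Fin r) ℝ} {x e : Ω → Fin r → ℝ}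
    {η : ℕ → Ω → Fin r → ℝ} {n : ℕ → Ω → Sig p m q → ℝ} {k : ℕ}
    (h : FilterMoments μ P x e η n k) (hη : IsWhiteNoise μ η S.Q) (hn : IsWhiteNoise μ n S.Sn)
    (hηn : ∀ i j, corr μ (η i) (n j) = 0) (hR : S.R.PosDef)
    (Φ : Matrix (Fin r) (Fin r) ℝ) (b : Fin r → ℝ) {pe ν x' e' : Ω → Fin r → ℝ}
    (hpe : pe = fun ω => S.Ep *ᵥ e ω + η k ω)
    (hν : ν = fun ω => S.gain (S.priorCov P) *ᵥ (S.Fcur *ᵥ pe ω + n k ω))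
    (hx' : x' = fun ω => Φ *ᵥ x ω + b + ν ω) (he' : e' = fun ω => pe ω - ν ω) :
    FilterMoments μ (S.riccatiStep P) x' e' η n (k + 1) ∧
      corr μ x' x' =
        corr μ (fun ω => Φ *ᵥ x ω + b) (fun ω => Φ *ᵥ x ω + b) + S.N P := by
  have hQ := hη.posSemidef
  have hP : P.PosSemidef := h.cov_e ▸ corr_self_posSemidef h.memLp_e
  set K := S.gain (S.priorCov P) with hK
  have hEe := memLp_mulVec h.memLp_e S.Ep
  have hpe2 : MemLp pe 2 μ := hpe ▸ hEe.add (hη.memLp k)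
  have hFpe := memLp_mulVec hpe2 S.Fcur
  have hι2 : MemLp (fun ω => S.Fcur *ᵥ pe ω + n k ω) 2 μ := hFpe.add (hn.memLp k)
  have hν2 : MemLp ν 2 μ := hν ▸ memLp_mulVec hι2 K
  have hΦx := memLp_mulVec h.memLp_x Φ
  have hb : MemLp (fun _ : Ω => b) 2 μ := memLp_const b
  set xp : Ω → Fin r → ℝ := fun ω => Φ *ᵥ x ω + b with hxp
  have hxp2 : MemLp xp 2 μ := hΦx.add hb
  have hx2 : MemLp x' 2 μ := hx' ▸ hxp2.add hν2
  have he2 : MemLp e' 2 μ := he' ▸ hpe2.sub hν2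
  have pe_Y : ∀ {κ : Type} [Fintype κ] {Y : Ω → κ → ℝ}, MemLp Y 2 μ →
      corr μ pe Y = S.Ep * corr μ e Y + corr μ (η k) Y := fun hY => by
    rw [hpe, corr_add_left hEe (hη.memLp k) hY, corr_mulVec_left h.memLp_e hY]
  have ν_Y : ∀ {κ : Type} [Fintype κ] {Y : Ω → κ → ℝ}, MemLp Y 2 μ →
      corr μ ν Y = K * (S.Fcur * corr μ pe Y + corr μ (n k) Y) := fun hY => by
    rw [hν, corr_mulVec_left hι2 hY, corr_add_left hFpe (hn.memLp k) hY,
      corr_mulVec_left hpe2 hY]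
  have xp_Y : ∀ {κ : Type} [Fintype κ] {Y : Ω → κ → ℝ}, MemLp Y 2 μ →
      (∀ j, ∫ ω, Y ω j ∂μ = 0) → corr μ xp Y = Φ * corr μ x Y := fun hY h0 => by
    rw [hxp, corr_add_left hΦx hb hY, corr_mulVec_left h.memLp_x hY, corr_const_left b h0, add_zero]
  have e'_Y : ∀ {κ : Type} [Fintype κ] {Y : Ω → κ → ℝ}, MemLp Y 2 μ →
      corr μ e' Y = corr μ pe Y - corr μ ν Y := fun hY => by
    rw [he', corr_sub_left hpe2 hν2 hY]
  have x'_Y : ∀ {κ : Type} [Fintype κ] {Y : Ω → κ → ℝ}, MemLp Y 2 μ →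
      corr μ x' Y = corr μ xp Y + corr μ ν Y := fun hY => by
    rw [hx', corr_add_left hxp2 hν2 hY]
  have η_e := corr_eq_zero_symm (h.e_η k le_rfl)
  have n_e := corr_eq_zero_symm (h.e_n k le_rfl)
  have e_pe : corr μ e pe = P * S.Epᵀ := by
    rw [hpe, corr_add_right hEe (hη.memLp k) h.memLp_e, corr_mulVec_right h.memLp_e h.memLp_e,
      h.cov_e, h.e_η k le_rfl, add_zero]
  have η_pe : corr μ (η k) pe = S.Q := by
    rw [hpe, corr_add_right hEe (hη.memLp k) (hη.memLp k),
      corr_mulVec_right h.memLp_e (hη.memLp k), η_e, hη.corr_self, Matrix.zero_mul, zero_add]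
  have pe_pe : corr μ pe pe = S.priorCov P := by
    rw [pe_Y hpe2, e_pe, η_pe, priorCov_eq, Matrix.mul_assoc]
  have n_pe : corr μ (n k) pe = 0 := by
    rw [hpe, corr_add_right hEe (hη.memLp k) (hn.memLp k),
      corr_mulVec_right h.memLp_e (hn.memLp k), n_e, corr_eq_zero_symm (hηn k k), Matrix.zero_mul,
      zero_add]
  have ν_pe : corr μ ν pe = S.N P := by
    rw [ν_Y hpe2, pe_pe, n_pe, add_zero, N_eq hQ hP, Matrix.mul_assoc]
  have pe_ν : corr μ pe ν = S.N P := by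
    rw [← corr_transpose, ν_pe, PosSemidef.transpose_eq (N_posSemidef hQ hR hP)]
  have n_ν : corr μ (n k) ν = S.Sn * Kᵀ := by
    rw [hν, corr_mulVec_right hι2 (hn.memLp k), corr_add_right hFpe (hn.memLp k) (hn.memLp k),
      corr_mulVec_right hpe2 (hn.memLp k), n_pe, hn.corr_self, Matrix.zero_mul, zero_add]
  have pe_ν' : corr μ pe ν = S.priorCov P * S.Fcurᵀ * Kᵀ := by
    rw [← corr_transpose, ν_Y hpe2, pe_pe, n_pe, add_zero, transpose_mul, transpose_mul,
      PosSemidef.transpose_eq (priorCov_posSemidef hQ hP)]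
  have ν_ν : corr μ ν ν = S.N P := by
    rw [ν_Y hν2, n_ν, pe_ν', N_eq_gain_mul_innovCov hQ hR hP, innovCov]
    simp only [Matrix.add_mul, Matrix.mul_add, Matrix.mul_assoc, ← hK]
  -- The orthogonality principle, which keeps the new estimate and the new error uncorrelated.
  have ν_e' : corr μ ν e' = 0 := by
    rw [he', corr_sub_right hpe2 hν2 hν2, ν_pe, ν_ν, sub_self]
  have pe_mean : ∀ j, ∫ ω, pe ω j ∂μ = 0 := fun j => by
    simp only [hpe, Pi.add_apply]
    rw [integral_add ((hEe.eval j).integrable (by norm_num))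
      (((hη.memLp k).eval j).integrable (by norm_num)),
      integral_mulVec_eq_zero h.memLp_e h.mean_e, hη.mean, add_zero]
  have ι_mean : ∀ j, ∫ ω, (S.Fcur *ᵥ pe ω + n k ω) j ∂μ = 0 := fun j => by
    simp only [Pi.add_apply]
    rw [integral_add ((hFpe.eval j).integrable (by norm_num))
      (((hn.memLp k).eval j).integrable (by norm_num)),
      integral_mulVec_eq_zero hpe2 pe_mean, hn.mean, add_zero]
  have ν_mean : ∀ j, ∫ ω, ν ω j ∂μ = 0 := fun j => by
    rw [hν]; exact integral_mulVec_eq_zero hι2 ι_mean K j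
  have e'_mean : ∀ j, ∫ ω, e' ω j ∂μ = 0 := fun j => by
    simp only [he', Pi.sub_apply]
    rw [integral_sub ((hpe2.eval j).integrable (by norm_num))
      ((hν2.eval j).integrable (by norm_num)), pe_mean, ν_mean, sub_zero]
  have x_pe : corr μ x pe = 0 := by
    rw [hpe, corr_add_right hEe (hη.memLp k) h.memLp_x, corr_mulVec_right h.memLp_e h.memLp_x,
      h.x_e, h.x_η k le_rfl, Matrix.zero_mul, add_zero]
  have x_ν : corr μ x ν = 0 := by
    rw [hν, corr_mulVec_right hι2 h.memLp_x, corr_add_right hFpe (hn.memLp k) h.memLp_x,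
      corr_mulVec_right hpe2 h.memLp_x, x_pe, h.x_n k le_rfl, Matrix.zero_mul, zero_add,
      Matrix.zero_mul]
  have xp_ν : corr μ xp ν = 0 := by rw [xp_Y hν2 ν_mean, x_ν, Matrix.mul_zero]
  have xp_e' : corr μ xp e' = 0 := by
    rw [xp_Y he2 e'_mean, he', corr_sub_right hpe2 hν2 h.memLp_x, x_pe, x_ν, sub_zero,
      Matrix.mul_zero]
  have pe_η : ∀ j, k + 1 ≤ j → corr μ pe (η j) = 0 := fun j hj => by
    rw [pe_Y (hη.memLp j), h.e_η j (by omega), hη.corr_of_ne (by omega), Matrix.mul_zero, add_zero]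
  have ν_η : ∀ j, k + 1 ≤ j → corr μ ν (η j) = 0 := fun j hj => by
    rw [ν_Y (hη.memLp j), pe_η j hj, corr_eq_zero_symm (hηn j k), Matrix.mul_zero, add_zero,
      Matrix.mul_zero]
  have pe_n : ∀ j, k + 1 ≤ j → corr μ pe (n j) = 0 := fun j hj => by
    rw [pe_Y (hn.memLp j), h.e_n j (by omega), hηn, Matrix.mul_zero, add_zero]
  have ν_n : ∀ j, k + 1 ≤ j → corr μ ν (n j) = 0 := fun j hj => by
    rw [ν_Y (hn.memLp j), pe_n j hj, hn.corr_of_ne (by omega), Matrix.mul_zero, add_zero,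
      Matrix.mul_zero]
  refine ⟨⟨hx2, he2, e'_mean, ?_, ?_, fun j hj => ?_, fun j hj => ?_, fun j hj => ?_,
    fun j hj => ?_⟩, ?_⟩
  · rw [e'_Y he2, ν_e', sub_zero, he', corr_sub_right hpe2 hν2 hpe2, pe_pe, pe_ν, N_eq hQ hP,
      riccatiStep, Matrix.sub_mul, Matrix.one_mul]
  · rw [x'_Y he2, xp_e', ν_e', add_zero]
  · rw [x'_Y (hη.memLp j), xp_Y (hη.memLp j) (hη.mean j), h.x_η j (by omega), ν_η j hj,
      Matrix.mul_zero, add_zero]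
  · rw [e'_Y (hη.memLp j), pe_η j hj, ν_η j hj, sub_zero]
  · rw [x'_Y (hn.memLp j), xp_Y (hn.memLp j) (hn.mean j), h.x_n j (by omega), ν_n j hj,
      Matrix.mul_zero, add_zero]
  · rw [e'_Y (hn.memLp j), pe_n j hj, ν_n j hj, sub_zero]
  · rw [x'_Y hx2, hx', corr_add_right hxp2 hν2 hxp2, corr_add_right hxp2 hν2 hν2, xp_ν,
      corr_eq_zero_symm xp_ν, ν_ν, add_zero, zero_add]

end Moments

/-! ### The matrix inequalities -/

section LMI

variable {p m q L r : ℕ} {S : Setup p m q L r} {W : Matrix (Fin r) (Fin r) ℝ}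

/-- A Schur complement in quadratic form: the test vector `(1, W⁻¹x, -Fy x, -W⁻¹v)`, with `v` the
prior estimate, annihilates the last two block rows, and the remaining terms are the inequality. -/
theorem dissipation {φ : ℝ} {Y : Matrix (Fin m) (Fin r) ℝ} {ξ : Fin m → ℝ} {dbar : Fin q → ℝ}
    (hW : W.PosDef) (h : (S.dissLMI φ W Y ξ dbar).PosSemidef) (x : Fin r → ℝ) :
    S.prior W Y ξ dbar x ⬝ᵥ (W⁻¹ *ᵥ S.prior W Y ξ dbar x) + (S.Fy *ᵥ x) ⬝ᵥ (S.Fy *ᵥ x) ≤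
      x ⬝ᵥ (W⁻¹ *ᵥ x) + φ := by
  have hdet := (Matrix.isUnit_iff_isUnit_det _).1 hW.isUnit
  have hWW : ∀ v, W *ᵥ (W⁻¹ *ᵥ v) = v := fun v => by
    rw [mulVec_mulVec, mul_nonsing_inv _ hdet, one_mulVec]
  set b := S.Ff *ᵥ dbar + S.Fz *ᵥ ξ with hb
  set v := S.prior W Y ξ dbar x with hv
  set G := S.Fp * W + S.Fz * Y with hG
  have hGx : G *ᵥ (W⁻¹ *ᵥ x) + b = v := by
    rw [hv, prior, hG, mulVec_mulVec, Matrix.add_mul, Matrix.mul_assoc, mul_nonsing_inv _ hdet,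
      Matrix.mul_one, hb, add_assoc]
  have hFx : (S.Fy * W) *ᵥ (W⁻¹ *ᵥ x) = S.Fy *ᵥ x := by rw [← mulVec_mulVec, hWW]
  have key := PosSemidef.quadratic_nonneg h (Sum.elim (fun _ => (1 : ℝ))
    (Sum.elim (W⁻¹ *ᵥ x) (Sum.elim (-(S.Fy *ᵥ x)) (-(W⁻¹ *ᵥ v)))))
  have h1 : (S.dissLMI φ W Y ξ dbar) *ᵥ (Sum.elim (fun _ => (1 : ℝ))
      (Sum.elim (W⁻¹ *ᵥ x) (Sum.elim (-(S.Fy *ᵥ x)) (-(W⁻¹ *ᵥ v))))) =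
      Sum.elim (fun _ => φ - b ⬝ᵥ (W⁻¹ *ᵥ v))
        (Sum.elim (x - (S.Fy * W)ᵀ *ᵥ (S.Fy *ᵥ x) - Gᵀ *ᵥ (W⁻¹ *ᵥ v)) (Sum.elim 0 0)) := by
    have hcol : replicateCol Unit b *ᵥ (fun _ => (1 : ℝ)) = b := by
      funext i; simp [mulVec, dotProduct]
    have hrow : (replicateCol Unit b)ᵀ *ᵥ (W⁻¹ *ᵥ v) = fun _ => b ⬝ᵥ (W⁻¹ *ᵥ v) := rfl
    have hφ : (of fun _ _ : Unit => φ) *ᵥ (fun _ => (1 : ℝ)) = fun _ => φ := by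
      funext i; simp [mulVec, dotProduct]
    rw [dissLMI, fromBlocks_mulVec]
    simp only [Sum.elim_comp_inl, Sum.elim_comp_inr, fromCols_mulVec_sumElim, fromRows_mulVec,
      fromBlocks_mulVec, mulVec_neg, ← hb, ← hG, hcol, hrow, hφ, hFx, hWW, zero_mulVec,
      one_mulVec]
    congr 1
    · funext i; simp [sub_eq_add_neg]
    · ext (i | i | i)
      · simp; ring
      · simp
      · have := congrFun hGx i
        simp only [Pi.add_apply] at this
        simp [← this]
  rw [h1] at key
  simp only [sumElim_dotProduct_sumElim, dotProduct_zero, add_zero, dotProduct_sub] at key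
  have h2 : (W⁻¹ *ᵥ x) ⬝ᵥ ((S.Fy * W)ᵀ *ᵥ (S.Fy *ᵥ x)) = (S.Fy *ᵥ x) ⬝ᵥ (S.Fy *ᵥ x) := by
    rw [mulVec_transpose, dotProduct_comm, ← dotProduct_mulVec, hFx]
  have h3 : (W⁻¹ *ᵥ x) ⬝ᵥ (Gᵀ *ᵥ (W⁻¹ *ᵥ v)) = (v - b) ⬝ᵥ (W⁻¹ *ᵥ v) := by
    rw [mulVec_transpose, dotProduct_comm, ← dotProduct_mulVec, ← hGx, add_sub_cancel_right,
      dotProduct_comm]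
  rw [h2, h3, sub_dotProduct, dotProduct_comm (W⁻¹ *ᵥ x) x] at key
  simp only [dotProduct, Finset.univ_unique, Finset.sum_singleton, one_mul] at key ⊢
  linarith

/-- The diagonal of the Schur complement of the block `diag(W, I)` is nonnegative; summing it and
cycling the square roots under the trace gives the bound. -/
theorem offset_trace_le {P X : Matrix (Fin r) (Fin r) ℝ} (hW : W.PosDef) (hN : (S.N P).PosSemidef)
    (hP : P.PosSemidef) (h : (S.offsetLMI P W X).PosSemidef) :
    (W⁻¹ * S.N P).trace + (S.Fyᵀ * S.Fy * P).trace ≤ X.trace := by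
  have hdet := (Matrix.isUnit_iff_isUnit_det _).1 hW.isUnit
  obtain ⟨hM, hMM⟩ := psdSqrt_spec hN
  obtain ⟨hQ, hQQ⟩ := psdSqrt_spec hP
  set M := psdSqrt (S.N P) with hMd
  set Q := psdSqrt P with hQd
  have key : ∀ i : Fin r, 0 ≤ (X - Mᵀ * (W⁻¹ * M) - (S.Fy * Q)ᵀ * (S.Fy * Q)) i i := by
    intro i
    have := PosSemidef.quadratic_nonneg h
      (Sum.elim (Pi.single i 1) (Sum.elim (-((W⁻¹ * M) *ᵥ Pi.single i 1))
        (-((S.Fy * Q) *ᵥ Pi.single i 1))))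
    have h1 : S.offsetLMI P W X *ᵥ (Sum.elim (Pi.single i 1)
        (Sum.elim (-((W⁻¹ * M) *ᵥ Pi.single i 1)) (-((S.Fy * Q) *ᵥ Pi.single i 1)))) =
        Sum.elim ((X - Mᵀ * (W⁻¹ * M) - (S.Fy * Q)ᵀ * (S.Fy * Q)) *ᵥ Pi.single i 1)
          (Sum.elim 0 0) := by
      rw [offsetLMI, fromBlocks_mulVec]
      simp only [Sum.elim_comp_inl, Sum.elim_comp_inr, fromCols_mulVec_sumElim, fromRows_mulVec,
        fromBlocks_mulVec, mulVec_neg, mulVec_mulVec, mul_nonsing_inv_cancel_left _ _ hdet,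
        Matrix.sub_mulVec]
      congr 1
      · abel
      · ext (i | i) <;> simp [hMd, hQd]
    rw [h1] at this
    simpa using this
  have htr := Finset.sum_nonneg fun i (_ : i ∈ Finset.univ) => key i
  have htr' : 0 ≤ (X - Mᵀ * (W⁻¹ * M) - (S.Fy * Q)ᵀ * (S.Fy * Q)).trace := htr
  have h1 : (Mᵀ * (W⁻¹ * M)).trace = (W⁻¹ * S.N P).trace := by
    rw [PosSemidef.transpose_eq hM, trace_mul_comm, Matrix.mul_assoc, hMM]
  have h2 : ((S.Fy * Q)ᵀ * (S.Fy * Q)).trace = (S.Fyᵀ * S.Fy * P).trace := by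
    rw [transpose_mul, PosSemidef.transpose_eq hQ, Matrix.mul_assoc, trace_mul_comm,
      ← hQQ]
    simp only [Matrix.mul_assoc]
  rw [trace_sub, trace_sub, h1, h2] at htr'
  linarith

end LMI

end Setup
end ProbGain

namespace ProbGain

/-! ### Averages, Markov's inequality and the law of large numbers -/

open scoped Topology

theorem tendsto_add_sum_div {c : ℕ → ℝ} {l : ℝ} (hc : Tendsto c atTop (𝓝 l)) (a : ℝ) :
    Tendsto (fun T : ℕ => (a + ∑ k ∈ Finset.range T, c (k + 1)) / T) atTop (𝓝 l) := by
  have h1 := ((tendsto_add_atTop_iff_nat 1).2 hc).cesaro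
  have h2 := (tendsto_const_div_atTop_nhds_zero_nat a).add h1
  rw [zero_add] at h2
  refine h2.congr fun T => ?_
  rw [add_div, div_eq_inv_mul (∑ k ∈ Finset.range T, c (k + 1))]

section Probability

variable {Ω : Type*} [MeasurableSpace Ω] {μ : Measure Ω} [IsProbabilityMeasure μ]

/-- No positivity of `b` is needed: if `√b = 0`, then `√a = 0` too, and `0 / 0 = 0` in `ℝ≥0∞`. -/
theorem ofReal_sqrt_div_le {a b γ : ℝ} (hγ : 0 ≤ γ) (h : a ≤ γ ^ 2 * b) :
    ENNReal.ofReal √a / ENNReal.ofReal √b ≤ ENNReal.ofReal γ := by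
  refine ENNReal.div_le_of_le_mul ?_
  rw [← ENNReal.ofReal_mul hγ]
  refine ENNReal.ofReal_le_ofReal ((Real.sqrt_le_sqrt h).trans_eq ?_)
  rw [Real.sqrt_mul (sq_nonneg γ), Real.sqrt_sq hγ]

/-- If the mean of `a T` grows at most like `c T` and `b T / T` tends to `D` almost surely, then
`√(a T) ≤ γ √(b T)` with probability at least `1 - c / (γ² D)` in the limit. -/
theorem le_liminf_measureReal_sqrt_div_le {a b : ℕ → Ω → ℝ} {s : ℕ → ℝ} {c D γ : ℝ}
    (ha0 : ∀ T ω, 0 ≤ a T ω) (hai : ∀ T, Integrable (a T) μ)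
    (hb : ∀ T, AEStronglyMeasurable (b T) μ) (hs : ∀ T, ∫ ω, a T ω ∂μ ≤ s T)
    (hsc : Tendsto (fun T : ℕ => s T / T) atTop (𝓝 c))
    (hbD : ∀ᵐ ω ∂μ, Tendsto (fun T : ℕ => b T ω / T) atTop (𝓝 D)) (hD : 0 < D) (hγ : 0 < γ) :
    1 - c / (γ ^ 2 * D) ≤ liminf (fun T : ℕ =>
      μ.real {ω | ENNReal.ofReal √(a T ω) / ENNReal.ofReal √(b T ω) ≤ ENNReal.ofReal γ})
        atTop := by
  have hmeas : TendstoInMeasure μ (fun (T : ℕ) ω => b T ω / T) atTop fun _ => D :=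
    tendstoInMeasure_of_tendsto_ae 
      (fun T => by simpa only [div_eq_mul_inv] using (hb T).mul_const _) hbD
  rw [tendstoInMeasure_iff_measureReal_dist] at hmeas
  set f : ℕ → ℝ := fun T => μ.real {ω | ENNReal.ofReal √(a T ω) / ENNReal.ofReal √(b T ω) ≤
    ENNReal.ofReal γ} with hf
  have hbdd : IsCoboundedUnder (· ≥ ·) atTop f :=
    isCoboundedUnder_ge_of_le atTop (x := 1) fun T => measureReal_le_one
  -- The ratio exceeds `γ` only if `b T / T` deviates from `D` by at least `D - D'`, which has
  -- vanishing probability, or `a T ≥ γ² D' T`, which Markov's inequality controls. Finally `D'`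
  -- increases to `D`.
  have hstep : ∀ D', 0 < D' → D' < D → 1 - c / (γ ^ 2 * D') ≤ liminf f atTop := by
    intro D' hD' hlt
    have hlow : ∀ᶠ T : ℕ in atTop,
        1 - μ.real {ω | D - D' ≤ dist (b T ω / T) D} - s T / T / (γ ^ 2 * D') ≤ f T := by
      filter_upwards [eventually_gt_atTop 0] with T hT
      have hT' : (0 : ℝ) < T := Nat.cast_pos.2 hT
      have hε : 0 < γ ^ 2 * D' * T := by positivity
      have hmarkov : μ.real {ω | γ ^ 2 * D' * T ≤ a T ω} ≤ s T / T / (γ ^ 2 * D') := by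
        have := mul_meas_ge_le_integral_of_nonneg (ae_of_all μ (ha0 T)) (hai T) (γ ^ 2 * D' * T)
        rw [div_div, le_div_iff₀ (by positivity)]
        calc _ = γ ^ 2 * D' * T * μ.real {ω | γ ^ 2 * D' * T ≤ a T ω} := by ring
          _ ≤ _ := this.trans (hs T)
      have hcover : (Set.univ : Set Ω) ⊆
          {ω | ENNReal.ofReal √(a T ω) / ENNReal.ofReal √(b T ω) ≤ ENNReal.ofReal γ} ∪
          ({ω | D - D' ≤ dist (b T ω / T) D} ∪ {ω | γ ^ 2 * D' * T ≤ a T ω}) := by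
        intro ω _
        by_contra hω
        simp only [Set.mem_union, Set.mem_ofPred_eq, not_or, not_le] at hω
        obtain ⟨h1, h2, h3⟩ := hω
        refine absurd (ofReal_sqrt_div_le hγ.le ?_) (not_le.2 h1)
        rw [Real.dist_eq, abs_sub_comm] at h2
        have h4 : D' < b T ω / T := by linarith [le_abs_self (D - b T ω / T)]
        rw [lt_div_iff₀ hT'] at h4
        have : γ ^ 2 * (D' * T) ≤ γ ^ 2 * b T ω := by gcongr
        linarith
      have h1 := measureReal_mono (μ := μ) hcover
      rw [probReal_univ] at h1
      have h2 := h1.trans (measureReal_union_le _ _)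
      have h3 := measureReal_union_le (μ := μ) {ω | D - D' ≤ dist (b T ω / T) D}
        {ω | γ ^ 2 * D' * T ≤ a T ω}
      simp only [hf]
      linarith
    have hlim : Tendsto (fun T : ℕ => 1 - μ.real {ω | D - D' ≤ dist (b T ω / T) D}
        - s T / T / (γ ^ 2 * D')) atTop (𝓝 (1 - 0 - c / (γ ^ 2 * D'))) :=
      (tendsto_const_nhds.sub (hmeas _ (sub_pos.2 hlt))).sub (hsc.div_const _)
    rw [sub_zero] at hlim
    rw [← hlim.liminf_eq]
    exact liminf_le_liminf hlow hlim.isBoundedUnder_ge hbdd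
  have hcont : Tendsto (fun D' => 1 - c / (γ ^ 2 * D')) (𝓝[<] D) (𝓝 (1 - c / (γ ^ 2 * D))) := by
    have : ContinuousAt (fun D' => 1 - c / (γ ^ 2 * D')) D := by
      fun_prop (disch := positivity)
    exact this.tendsto.mono_left nhdsWithin_le_nhds
  refine le_of_tendsto hcont ?_
  filter_upwards [Ioo_mem_nhdsLT hD] with D' hD'
  exact hstep D' hD'.1 hD'.2

/-- The strong law of large numbers for the energy of an i.i.d. noise with an offset. -/
theorem IsIIDNoise.tendsto_energy {ι : Type*} [Fintype ι] {v : ℕ → Ω → ι → ℝ} {C : Matrix ι ι ℝ}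
    (hv : IsIIDNoise μ v C) (c : ι → ℝ) :
    ∀ᵐ ω ∂μ, Tendsto (fun T : ℕ => (∑ k ∈ Finset.range T, ∑ i, (c i + v k ω i) ^ 2) / T) atTop
      (𝓝 (C.trace + c ⬝ᵥ c)) := by
  set φ : (ι → ℝ) → ℝ := fun x => ∑ i, (c i + x i) ^ 2 with hφ
  have hφm : Measurable φ := by fun_prop
  have hsq : ∀ i, Integrable (fun ω => (c i + v 0 ω i) ^ 2) μ := fun i =>
    ((memLp_const (c i)).add ((hv.memLp 0).eval i)).integrable_sq
  have hint : Integrable (fun ω => φ (v 0 ω)) μ := integrable_finsetSum _ fun i _ => hsq i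
  have hmean : ∫ ω, φ (v 0 ω) ∂μ = C.trace + c ⬝ᵥ c := by
    simp only [hφ]
    rw [integral_finsetSum _ fun i _ => hsq i, trace, dotProduct, ← Finset.sum_add_distrib]
    refine Finset.sum_congr rfl fun i _ => ?_
    have h1 : Integrable (fun ω => v 0 ω i) μ := ((hv.memLp 0).eval i).integrable (by norm_num)
    have h2 := integrable_coord_mul (hv.memLp 0) (hv.memLp 0) i i
    have : ∀ ω, (c i + v 0 ω i) ^ 2 = c i * c i + 2 * c i * v 0 ω i + v 0 ω i * v 0 ω i :=
      fun ω => by ring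
    simp_rw [this]
    have h3 : Integrable (fun ω => c i * c i + 2 * c i * v 0 ω i) μ :=
      (integrable_const _).add (h1.const_mul _)
    rw [integral_add h3 h2, integral_add (integrable_const _) (h1.const_mul _), integral_const_mul (2 * c i), hv.mean, hv.cov]
    simp [add_comm]
  rw [← hmean]
  exact strong_law_ae_real (fun k ω => φ (v k ω)) hint
    (fun i j hij => (hv.indep.indepFun hij).comp hφm hφm) fun k => (hv.ident k).comp hφm

end Probability

/-! ### The closed loop in the mean -/

namespace Setup

variable {p m q L r : ℕ} {S : Setup p m q L r} {Ω : Type*} [MeasurableSpace Ω] {μ : Measure Ω}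
  [IsProbabilityMeasure μ]

/-- The deviations of disturbance and input act on the parameterizer as a white noise. -/
theorem isWhiteNoise_processNoise {dd : ℕ → Ω → Fin q → ℝ} {du : ℕ → Ω → Fin m → ℝ}
    (hdd : IsWhiteNoise μ dd S.Sd) (hdu : IsWhiteNoise μ du S.Su)
    (hdu_dd : ∀ j k, corr μ (du j) (dd k) = 0) :
    IsWhiteNoise μ (fun k ω => S.Ef *ᵥ dd k ω + S.Eu *ᵥ du k ω) S.Q := by
  have h1 := fun k => memLp_mulVec (hdd.memLp k) S.Ef
  have h2 := fun k => memLp_mulVec (hdu.memLp k) S.Eu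
  have h12 : ∀ k, MemLp (fun ω => S.Ef *ᵥ dd k ω + S.Eu *ᵥ du k ω) 2 μ :=
    fun k => (h1 k).add (h2 k)
  have hcorr : ∀ j k, corr μ (fun ω => S.Ef *ᵥ dd j ω + S.Eu *ᵥ du j ω)
      (fun ω => S.Ef *ᵥ dd k ω + S.Eu *ᵥ du k ω) =
      S.Ef * corr μ (dd j) (dd k) * S.Efᵀ + S.Eu * corr μ (du j) (du k) * S.Euᵀ := by
    intro j k
    rw [corr_add_left (h1 j) (h2 j) (h12 k),
      corr_add_right (h1 k) (h2 k) (h1 j), corr_add_right (h1 k) (h2 k) (h2 j),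
      corr_mulVec_left (hdd.memLp j) (h1 k), corr_mulVec_left (hdd.memLp j) (h2 k),
      corr_mulVec_left (hdu.memLp j) (h1 k), corr_mulVec_left (hdu.memLp j) (h2 k),
      corr_mulVec_right (hdd.memLp k) (hdd.memLp j), corr_mulVec_right (hdu.memLp k) (hdd.memLp j),
      corr_mulVec_right (hdd.memLp k) (hdu.memLp j), corr_mulVec_right (hdu.memLp k) (hdu.memLp j),
      hdu_dd, corr_eq_zero_symm (hdu_dd k j)]
    simp only [Matrix.zero_mul, Matrix.mul_zero, add_zero, zero_add, Matrix.mul_assoc]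
  refine isWhiteNoise_of_corr h12 (fun k a => ?_) (fun k => ?_)
    fun j k hjk => ?_
  · simp only [Pi.add_apply]
    rw [integral_add (((h1 k).eval a).integrable (by norm_num))
      (((h2 k).eval a).integrable (by norm_num)),
      integral_mulVec_eq_zero (hdd.memLp k) (hdd.mean k),
      integral_mulVec_eq_zero (hdu.memLp k) (hdu.mean k), add_zero]
  · rw [hcorr, hdd.corr_self, hdu.corr_self, Q]
  · rw [hcorr, hdd.corr_of_ne hjk, hdu.corr_of_ne hjk]
    simp

theorem memLp_prior (W : Matrix (Fin r) (Fin r) ℝ) (Y : Matrix (Fin m) (Fin r) ℝ)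
    (ξ : Fin m → ℝ) (dbar : Fin q → ℝ) {x : Ω → Fin r → ℝ} (hx : MemLp x 2 μ) :
    MemLp (fun ω => S.prior W Y ξ dbar (x ω)) 2 μ := by
  have h1 := memLp_mulVec hx (S.Fp + S.Fz * Y * W⁻¹)
  have h2 : MemLp (fun _ : Ω => S.Ff *ᵥ dbar) 2 μ := memLp_const _
  have h3 : MemLp (fun _ : Ω => S.Fz *ᵥ ξ) 2 μ := memLp_const _
  exact (h1.add h2).add h3

/-- The storage function decreases in the mean up to the supply. -/
theorem storage_step {W : Matrix (Fin r) (Fin r) ℝ} {Y : Matrix (Fin m) (Fin r) ℝ}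
    {ξ : Fin m → ℝ} {dbar : Fin q → ℝ} {φ : ℝ} (hW : W.PosDef)
    (h : (S.dissLMI φ W Y ξ dbar).PosSemidef) {x : Ω → Fin r → ℝ} (hx : MemLp x 2 μ) :
    (W⁻¹ * corr μ (fun ω => S.prior W Y ξ dbar (x ω)) (fun ω => S.prior W Y ξ dbar (x ω))).trace
      + (S.Fyᵀ * S.Fy * corr μ x x).trace ≤ (W⁻¹ * corr μ x x).trace + φ := by
  have hxp := memLp_prior (S := S) W Y ξ dbar hx
  rw [← integral_quadratic hxp, ← integral_quadratic hx, ← integral_quadratic hx]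
  have hc : ∫ _ω : Ω, φ ∂μ = φ := by simp
  nth_rw 1 [← hc]
  rw [← integral_add (integrable_quadratic hxp _) (integrable_quadratic hx _),
    ← integral_add (integrable_quadratic hx _) (integrable_const _)]
  refine integral_mono ((integrable_quadratic hxp _).add (integrable_quadratic hx _))
    ((integrable_quadratic hx _).add (integrable_const _)) fun ω => ?_
  have := dissipation hW h (x ω)
  have h1 : x ω ⬝ᵥ ((S.Fyᵀ * S.Fy) *ᵥ x ω) = (S.Fy *ᵥ x ω) ⬝ᵥ (S.Fy *ᵥ x ω) := by
    rw [← mulVec_mulVec, mulVec_transpose, dotProduct_comm, ← dotProduct_mulVec]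
  simp only [h1]
  exact this

/-- Brings any controlled process into the form that `FilterMoments.step` propagates, with `x` the
posterior estimate, `e` its error and `η` the process noise. -/
theorem IsControlled.exists_filterMoments {B : Set (Traj p m q)} (hio : IsInputOutput B)
    (hF : S.Represents B) (hFz : S.IsVirtualInputBasis)
    {dd : ℕ → Ω → Fin q → ℝ} {du : ℕ → Ω → Fin m → ℝ} {n : ℕ → Ω → Sig p m q → ℝ}
    (hdd : IsWhiteNoise μ dd S.Sd) (hdu : IsWhiteNoise μ du S.Su) (hn : IsWhiteNoise μ n S.Sn)
    (hdu_dd : IndepFun (path du) (path dd) μ) (hdu_n : IndepFun (path du) (path n) μ)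
    (hdd_n : IndepFun (path dd) (path n) μ)
    {g₀ ghat₀ : Ω → Fin r → ℝ} {P₀ : Matrix (Fin r) (Fin r) ℝ}
    (hghat₀ : MemLp ghat₀ 2 μ) (he₀ : MemLp (fun ω => g₀ ω - ghat₀ ω) 2 μ)
    (he₀_mean : ∀ i, ∫ ω, (g₀ ω - ghat₀ ω) i ∂μ = 0)
    (he₀_cov : corr μ (fun ω => g₀ ω - ghat₀ ω) (fun ω => g₀ ω - ghat₀ ω) = P₀)
    (hghat₀_e₀ : IndepFun ghat₀ (fun ω => g₀ ω - ghat₀ ω) μ)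
    (hinit_dd : IndepFun (fun ω => (g₀ ω, ghat₀ ω)) (path dd) μ)
    (hinit_du : IndepFun (fun ω => (g₀ ω, ghat₀ ω)) (path du) μ)
    (hinit_n : IndepFun (fun ω => (g₀ ω, ghat₀ ω)) (path n) μ) (hR : S.R.PosDef)
    {dbar : Fin q → ℝ} {W : Matrix (Fin r) (Fin r) ℝ} {Y : Matrix (Fin m) (Fin r) ℝ}
    {ξ : Fin m → ℝ} {w : ℕ → Ω → Sig p m q → ℝ}
    (hw : S.IsControlled B W Y ξ dbar P₀ g₀ ghat₀ dd du n w) :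
    ∃ (x e : ℕ → Ω → Fin r → ℝ) (η : ℕ → Ω → Fin r → ℝ), IsWhiteNoise μ η S.Q ∧
      (∀ k ω, w (L + 1 + k) ω = S.Fcur *ᵥ (x (k + 1) ω + e (k + 1) ω)) ∧
      (∀ k, FilterMoments μ (S.postCov P₀ k) (x k) (e k) η n k) ∧
      ∀ k, corr μ (x (k + 1)) (x (k + 1)) =
        corr μ (fun ω => S.prior W Y ξ dbar (x k ω)) (fun ω => S.prior W Y ξ dbar (x k ω)) +
          S.N (S.postCov P₀ k) := by
  obtain ⟨g, hg0, hgw, hg⟩ := hw.exists_param hio hF hFz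
  set x : ℕ → Ω → Fin r → ℝ := fun k ω =>
    S.posterior W Y ξ dbar P₀ (ghat₀ ω) (fun t => w t ω) (fun t => n t ω) k with hx
  set e : ℕ → Ω → Fin r → ℝ := fun k ω => g k ω - x k ω with he
  set η : ℕ → Ω → Fin r → ℝ := fun k ω => S.Ef *ᵥ dd k ω + S.Eu *ᵥ du k ω with hη
  have hpath : ∀ {ι : Type} (k : ℕ), Measurable fun v : ℕ → ι → ℝ => v k :=
    fun k => measurable_pi_apply k
  have hηw : IsWhiteNoise μ η S.Q := isWhiteNoise_processNoise hdd hdu fun j k =>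
    (hdu_dd.comp (hpath j) (hpath k)).corr_eq_zero (hdu.memLp j) (hdd.memLp k) (hdd.mean k)
  have hηn : ∀ j k, corr μ (η j) (n k) = 0 := fun j k => by
    have h1 : corr μ (dd j) (n k) = 0 :=
      (hdd_n.comp (hpath j) (hpath k)).corr_eq_zero (hdd.memLp j) (hn.memLp k) (hn.mean k)
    have h2 : corr μ (du j) (n k) = 0 :=
      (hdu_n.comp (hpath j) (hpath k)).corr_eq_zero (hdu.memLp j) (hn.memLp k) (hn.mean k)
    rw [hη, corr_add_left (memLp_mulVec (hdd.memLp j) _) (memLp_mulVec (hdu.memLp j) _)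
      (hn.memLp k), corr_mulVec_left (hdd.memLp j) (hn.memLp k),
      corr_mulVec_left (hdu.memLp j) (hn.memLp k), h1, h2]
    simp
  have hinit : ∀ {ι : Type} [Fintype ι] {v : ℕ → Ω → ι → ℝ} {C : Matrix ι ι ℝ}
      {f : (Fin r → ℝ) × (Fin r → ℝ) → Fin r → ℝ}, IsWhiteNoise μ v C → Measurable f →
      IndepFun (fun ω => (g₀ ω, ghat₀ ω)) (path v) μ →
      MemLp (fun ω => f (g₀ ω, ghat₀ ω)) 2 μ → ∀ k,
      corr μ (fun ω => f (g₀ ω, ghat₀ ω)) (v k) = 0 := fun hv hf hi hm k =>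
    (hi.comp hf (hpath k)).corr_eq_zero hm (hv.memLp k) (hv.mean k)
  have hsub : Measurable fun z : (Fin r → ℝ) × (Fin r → ℝ) => z.1 - z.2 :=
    measurable_fst.sub measurable_snd
  have hη_of : ∀ {X : Ω → Fin r → ℝ}, MemLp X 2 μ → (∀ k, corr μ X (dd k) = 0) →
      (∀ k, corr μ X (du k) = 0) → ∀ k, corr μ X (η k) = 0 := fun hX h1 h2 k => by
    rw [hη, corr_add_right (memLp_mulVec (hdd.memLp k) _) (memLp_mulVec (hdu.memLp k) _) hX,
      corr_mulVec_right (hdd.memLp k) hX, corr_mulVec_right (hdu.memLp k) hX, h1, h2]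
    simp
  have hx0 : x 0 = ghat₀ := rfl
  have he0 : e 0 = fun ω => g₀ ω - ghat₀ ω := by
    funext ω; change g 0 ω - ghat₀ ω = _; rw [hg0]
  have hu := isUnit_Fu_mul_Fz hio hF hFz
  -- Truth and prior are both values of `advance`; the planned input and the mean disturbance cancel
  -- in their difference.
  have hpe : ∀ k ω, g (k + 1) ω - S.prior W Y ξ dbar (x k ω) = S.Ep *ᵥ e k ω + η k ω := by
    intro k ω
    rw [prior_eq_advance hu, hg, advance_sub_advance, add_sub_cancel_left, add_sub_cancel_left]
  have hx' : ∀ k, x (k + 1) = fun ω => (S.Fp + S.Fz * Y * W⁻¹) *ᵥ x k ω +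
      (S.Ff *ᵥ dbar + S.Fz *ᵥ ξ) + S.gain (S.priorCov (S.postCov P₀ k)) *ᵥ
        (S.Fcur *ᵥ (S.Ep *ᵥ e k ω + η k ω) + n k ω) := by
    intro k
    funext ω
    rw [← hpe, ← add_assoc]
    simp only [hx]
    rw [posterior, hgw, mulVec_sub S.Fcur, sub_add_eq_add_sub]
    rfl
  have he' : ∀ k, e (k + 1) = fun ω => (S.Ep *ᵥ e k ω + η k ω) -
      S.gain (S.priorCov (S.postCov P₀ k)) *ᵥ
        (S.Fcur *ᵥ (S.Ep *ᵥ e k ω + η k ω) + n k ω) := by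
    intro k
    funext ω
    have h1 := hpe k ω
    rw [sub_eq_iff_eq_add] at h1
    have h2 := congrFun (hx' k) ω
    simp only [he] at h1 h2 ⊢
    rw [h1, h2, prior]
    abel
  have hprior : ∀ k, (fun ω => S.prior W Y ξ dbar (x k ω)) = fun ω =>
      (S.Fp + S.Fz * Y * W⁻¹) *ᵥ x k ω + (S.Ff *ᵥ dbar + S.Fz *ᵥ ξ) := fun k => by
    funext ω; rw [prior, add_assoc]
  have hmom : ∀ k, FilterMoments μ (S.postCov P₀ k) (x k) (e k) η n k := by
    intro k
    induction k with
    | zero =>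
      rw [hx0, he0]
      exact ⟨hghat₀, he₀, he₀_mean, he₀_cov, hghat₀_e₀.corr_eq_zero hghat₀ he₀ he₀_mean,
        fun j _ => hη_of hghat₀ (hinit hdd measurable_snd hinit_dd hghat₀)
          (hinit hdu measurable_snd hinit_du hghat₀) j,
        fun j _ => hη_of he₀ (hinit hdd hsub hinit_dd he₀) (hinit hdu hsub hinit_du he₀) j,
        fun j _ => hinit hn measurable_snd hinit_n hghat₀ j,
        fun j _ => hinit hn hsub hinit_n he₀ j⟩
    | succ k ih => exact (ih.step hηw hn hηn hR _ _ rfl rfl (hx' k) (he' k)).1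
  refine ⟨x, e, η, hηw, fun k ω => ?_, hmom, fun k => ?_⟩
  · rw [hgw]; simp only [he, add_sub_cancel]
  · rw [hprior]
    exact ((hmom k).step hηw hn hηn hR _ _ rfl rfl (hx' k) (he' k)).2

/-- The output energy splits without a cross term because estimate and error are uncorrelated. -/
theorem FilterMoments.integral_output {Ω : Type*} [MeasurableSpace Ω] {μ : Measure Ω}
    {P : Matrix (Fin r) (Fin r) ℝ} {x e : Ω → Fin r → ℝ}
    {η : ℕ → Ω → Fin r → ℝ} {n : ℕ → Ω → Sig p m q → ℝ} {k : ℕ}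
    (h : FilterMoments μ P x e η n k) :
    Integrable (fun ω => ∑ a, (S.Fy *ᵥ (x ω + e ω)) a ^ 2) μ ∧
    ∫ ω, ∑ a, (S.Fy *ᵥ (x ω + e ω)) a ^ 2 ∂μ =
      (S.Fyᵀ * S.Fy * corr μ x x).trace + (S.Fyᵀ * S.Fy * P).trace := by
  have hg : MemLp (fun ω => x ω + e ω) 2 μ := h.memLp_x.add h.memLp_e
  have h1 : ∀ ω, ∑ a, (S.Fy *ᵥ (x ω + e ω)) a ^ 2 =
      (x ω + e ω) ⬝ᵥ ((S.Fyᵀ * S.Fy) *ᵥ (x ω + e ω)) := fun ω => by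
    rw [← mulVec_mulVec, mulVec_transpose, dotProduct_comm, ← dotProduct_mulVec]
    simp only [dotProduct, sq]
  simp_rw [h1]
  refine ⟨integrable_quadratic hg _, ?_⟩
  rw [integral_quadratic hg, corr_add_left h.memLp_x h.memLp_e hg,
    corr_add_right h.memLp_x h.memLp_e h.memLp_x, corr_add_right h.memLp_x h.memLp_e h.memLp_e,
    h.x_e, corr_eq_zero_symm h.x_e, h.cov_e, add_zero, zero_add, Matrix.mul_add, trace_add]

end Setup
end ProbGain

/-! ### The main theorem -/

theorem theorem2 {p m q L r : ℕ} {Ω : Type*} [MeasurableSpace Ω]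
    (μ : Measure Ω) [IsProbabilityMeasure μ]
    -- the system and its representation
    (B : Set (Traj p m q)) (hB : IsLTIBehavior L B) (hio : IsInputOutput B)
    (S : Setup p m q L r) (hF : S.Represents B) (hFz : S.IsVirtualInputBasis)
    -- the random deviations and the measurement noise
    (dd : ℕ → Ω → Fin q → ℝ) (du : ℕ → Ω → Fin m → ℝ) (n : ℕ → Ω → Sig p m q → ℝ)
    (hdd : IsIIDNoise μ dd S.Sd) (hdu : IsIIDNoise μ du S.Su) (hn : IsWhiteNoise μ n S.Sn)
    (hdu_dd : IndepFun (path du) (path dd) μ) (hdu_n : IndepFun (path du) (path n) μ)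
    (hdd_n : IndepFun (path dd) (path n) μ)
    -- the initial parameterizer, its estimate, and the error covariance of the estimate
    (g₀ ghat₀ : Ω → Fin r → ℝ) (P₀ : Matrix (Fin r) (Fin r) ℝ)
    (hghat₀ : MemLp ghat₀ 2 μ) (he₀ : MemLp (fun ω => g₀ ω - ghat₀ ω) 2 μ)
    (he₀_mean : ∀ i, ∫ ω, (g₀ ω - ghat₀ ω) i ∂μ = 0)
    (he₀_cov : ∀ i j, ∫ ω, (g₀ ω - ghat₀ ω) i * (g₀ ω - ghat₀ ω) j ∂μ = P₀ i j)
    (hghat₀_e₀ : IndepFun ghat₀ (fun ω => g₀ ω - ghat₀ ω) μ)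
    (hinit_dd : IndepFun (fun ω => (g₀ ω, ghat₀ ω)) (path dd) μ)
    (hinit_du : IndepFun (fun ω => (g₀ ω, ghat₀ ω)) (path du) μ)
    (hinit_n : IndepFun (fun ω => (g₀ ω, ghat₀ ω)) (path n) μ)
    -- the steady-state error covariance
    (hR : S.R.PosDef) (P : Matrix (Fin r) (Fin r) ℝ) (hP : S.IsTheARESolution P)
    -- the design
    (dbar : Fin q → ℝ) (hd : S.Sd.trace + dbar ⬝ᵥ dbar ≠ 0)
    (γ₁ γ₂ : ℝ) (hγ₁ : 0 ≤ γ₁) (hγ₂ : 0 ≤ γ₂)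
    (W X : Matrix (Fin r) (Fin r) ℝ) (Y : Matrix (Fin m) (Fin r) ℝ) (ξ : Fin m → ℝ)
    (hX : X.IsSymm) (hW : W.PosDef) (hoffset : (S.offsetLMI P W X).PosSemidef)
    (hdiss : (S.dissLMI (γ₁ ^ 2 * (dbar ⬝ᵥ dbar) + γ₂ ^ 2 * S.Sd.trace - X.trace)
      W Y ξ dbar).PosSemidef)
    (ρ : ℝ) (hρ : ρ = (dbar ⬝ᵥ dbar) / (S.Sd.trace + dbar ⬝ᵥ dbar)) :
    (∃ w, S.IsControlled B W Y ξ dbar P₀ g₀ ghat₀ dd du n w) ∧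
    ∀ w, S.IsControlled B W Y ξ dbar P₀ g₀ ghat₀ dd du n w →
      ∀ γ : ℝ, 0 < γ → √(ρ * γ₁ ^ 2 + (1 - ρ) * γ₂ ^ 2) ≤ γ →
        μ {_ω | 1 - 1 / γ ^ 2 * (ρ * γ₁ ^ 2 + (1 - ρ) * γ₂ ^ 2) ≤
          liminf (fun T : ℕ =>
            μ.real {ω | gainRatio L (fun t => w t ω) T ≤ ENNReal.ofReal γ}) atTop} = 1 := by
  refine ⟨Setup.exists_isControlled hB hio hF hFz, fun w hw γ hγ _ => ?_⟩
  have hcov : corr μ (fun ω => g₀ ω - ghat₀ ω) (fun ω => g₀ ω - ghat₀ ω) = P₀ :=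
    Matrix.ext he₀_cov
  have hP₀ : P₀.PosSemidef := hcov ▸ corr_self_posSemidef he₀
  obtain ⟨x, e, η, hη, hwg, hmom, hstep⟩ := hw.exists_filterMoments hio hF hFz hdd.toIsWhiteNoise
    hdu.toIsWhiteNoise hn hdu_dd hdu_n hdd_n hghat₀ he₀ he₀_mean hcov hghat₀_e₀ hinit_dd hinit_du
    hinit_n hR
  have hQ := hη.posSemidef
  have hSn := hn.posSemidef
  have hD0 : 0 < S.Sd.trace + dbar ⬝ᵥ dbar := by
    have h1 := hdd.posSemidef.trace_nonneg
    have h2 : 0 ≤ dbar ⬝ᵥ dbar := Finset.sum_nonneg fun i _ => mul_self_nonneg _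
    exact lt_of_le_of_ne (add_nonneg h1 h2) hd.symm
  set D := S.Sd.trace + dbar ⬝ᵥ dbar with hD
  set φ := γ₁ ^ 2 * (dbar ⬝ᵥ dbar) + γ₂ ^ 2 * S.Sd.trace - X.trace with hφ
  have hlim := Setup.tendsto_postCov hio hF hFz hQ hSn hR hP hP₀
  -- `J k` is the mean storage. The supply `c k` below is `φ` plus the transient cost of filtering,
  -- which converges with the covariance.
  set J : ℕ → ℝ := fun k => (W⁻¹ * corr μ (x k) (x k)).trace with hJ
  set c : ℕ → ℝ := fun k =>
    φ + ((W⁻¹ * S.N (S.postCov P₀ k)).trace + (S.Fyᵀ * S.Fy * S.postCov P₀ k).trace) with hc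
  have hJ0 : ∀ k, 0 ≤ J k := fun k => by
    simp only [hJ]
    rw [← integral_quadratic (hmom k).memLp_x]
    exact integral_nonneg fun ω => PosSemidef.quadratic_nonneg hW.posSemidef.inv _
  have henergy : ∀ k, ∫ ω, ∑ a, (S.Fy *ᵥ (x k ω + e k ω)) a ^ 2 ∂μ + J (k + 1) ≤ J k + c k := by
    intro k
    have h1 := Setup.storage_step hW hdiss (hmom k).memLp_x
    simp only [hJ, hc]
    rw [(hmom k).integral_output.2, hstep k, Matrix.mul_add, trace_add]
    linarith
  have hc_lim : Tendsto c atTop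
      (nhds (φ + ((W⁻¹ * S.N P).trace + (S.Fyᵀ * S.Fy * P).trace))) := by
    have htr : ∀ M : Matrix (Fin r) (Fin r) ℝ,
        Continuous fun Z : Matrix (Fin r) (Fin r) ℝ => (M * Z).trace := fun M => by fun_prop
    exact tendsto_const_nhds.add (((htr _).tendsto _).comp
      (Setup.tendsto_N hR hP.1.1 hlim) |>.add (((htr _).tendsto _).comp hlim))
  -- Telescoping starts at index `1`, since the output at time `L + 1 + k` is read off the state `k
  -- + 1`.
  have hsum : ∀ T, ∑ k ∈ Finset.range T, ∫ ω, ∑ a, (S.Fy *ᵥ (x (k + 1) ω + e (k + 1) ω)) a ^ 2 ∂μ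
      + J (T + 1) ≤ J 1 + ∑ k ∈ Finset.range T, c (k + 1) := by
    intro T
    induction T with
    | zero => simp
    | succ T ih =>
      rw [Finset.sum_range_succ, Finset.sum_range_succ]
      linarith [henergy (T + 1)]
  have hs_lim : Tendsto (fun T : ℕ => (J 1 + ∑ k ∈ Finset.range T, c (k + 1)) / T) atTop
      (nhds (φ + ((W⁻¹ * S.N P).trace + (S.Fyᵀ * S.Fy * P).trace))) :=
    tendsto_add_sum_div hc_lim _
  have hy : ∀ k ω a, w (L + 1 + k) ω (Sum.inl a) = (S.Fy *ᵥ (x (k + 1) ω + e (k + 1) ω)) a :=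
    fun k ω a => by rw [hwg]; rfl
  have hmain : 1 - (φ + ((W⁻¹ * S.N P).trace + (S.Fyᵀ * S.Fy * P).trace)) / (γ ^ 2 * D) ≤
      liminf (fun T : ℕ => μ.real {ω | gainRatio L (fun t => w t ω) T ≤ ENNReal.ofReal γ})
        atTop := by
    refine le_liminf_measureReal_sqrt_div_le
      (a := fun T ω => ∑ k ∈ Finset.range T, ∑ a : Fin p, w (L + 1 + k) ω (Sum.inl a) ^ 2)
      (b := fun T ω =>
        ∑ k ∈ Finset.range T, ∑ b : Fin q, w (L + 1 + k) ω (Sum.inr (Sum.inr b)) ^ 2)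
      (s := fun T => J 1 + ∑ k ∈ Finset.range T, c (k + 1))
      (fun T ω => by positivity) (fun T => ?_) (fun T => ?_) (fun T => ?_) hs_lim ?_ hD0 hγ
    · simp_rw [hy]
      exact integrable_finsetSum _ fun k _ => (hmom (k + 1)).integral_output.1
    · simp_rw [hw.disturbance]
      refine Finset.aestronglyMeasurable_fun_sum _ fun k _ =>
        Finset.aestronglyMeasurable_fun_sum _ fun b _ => ?_
      exact (((hdd.memLp k).eval b).aestronglyMeasurable.const_add _).pow 2
    · simp_rw [hy]
      rw [integral_finsetSum _ fun k _ => (hmom (k + 1)).integral_output.1]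
      linarith [hsum T, hJ0 (T + 1)]
    · simp_rw [hw.disturbance]
      exact hdd.tendsto_energy dbar
  have htrace := Setup.offset_trace_le hW (Setup.N_posSemidef hQ hR hP.1.1) hP.1.1 hoffset
  have hbound : 1 - 1 / γ ^ 2 * (ρ * γ₁ ^ 2 + (1 - ρ) * γ₂ ^ 2) ≤
      1 - (φ + ((W⁻¹ * S.N P).trace + (S.Fyᵀ * S.Fy * P).trace)) / (γ ^ 2 * D) := by
    -- Here `φ + tr X = γ₁²‖d̄‖² + γ₂² tr S_d`, and `ρ`, `1 - ρ` are the shares of `‖d̄‖²` and `tr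
    -- S_d` in `D`.
    have h1 : 1 / γ ^ 2 * (ρ * γ₁ ^ 2 + (1 - ρ) * γ₂ ^ 2) = (φ + X.trace) / (γ ^ 2 * D) := by
      have h2 : S.Sd.trace = D - dbar ⬝ᵥ dbar := by rw [hD]; ring
      rw [hρ, hφ, h2]
      field_simp
      ring
    rw [h1]
    gcongr
  -- The outer event does not depend on the sample point, so it is the whole space once the
  -- inequality holds.
  refine (congrArg μ (Set.eq_univ_iff_forall.2 fun _ => ?_)).trans measure_univ
  exact hbound.trans hmain
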